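/- **Model.** In the Congested Clique, $n$ nodes with identifiers $1,\dots,n$ compute in synchronous rounds; in each round every node may send a message of $O(\log n)$ bits to each other node. Local computation is unrestricted, and in randomized algorithms each node has private random bits. The input is a simple undirected graph $G=(V,E)$, $|V|=n$, whose edge weights are positive integers bounded by $n^{p}$ for a constant $p$; each node initially knows its incident edges and their weights. Let $d=d_G$ be the weighted distance ($\infty$ between different components). For $\alpha\ge 1$, an $\alpha$-approximation of APSP on a graph $H$ is a function $f$ with $d_H(u,v)\le f(u,v)\le\alpha\, d_H(u,v)$ for all nodes $u,v$ of $H$, where each node $u$ knows the values $f(u,\cdot)$. With high probability (w.h.p.) means with probability at least $1-n^{-c}$, where $c$ is an arbitrary constant; the constants in the round bounds, in the message size and in the exponent bounding the weights of $G_S$ below may depend on $p$ and $c$ only, and the constant in the bound on $|V_S|$ is absolute. **Lemma 6.1 (Skeleton graphs).** Let $a\ge 1$ be a real number and $k\ge 1$ an integer. Let $\delta$ be a symmetric integer-valued function on pairs of nodes of $G$. Suppose that each node $u$ is given a set $\tilde N_k(u)$ of $k$ nodes such that * for each $v\in\tilde N_k(u)$, the value $\delta(u,v)$ is known to $u$ and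 $d(u,v)\le\delta(u,v)\le a\cdot d(u,v)$; * for all $v\in\tilde N_k(u)$ and $t\notin\tilde N_k(u)$, $\delta(u,v)\le a\cdot d(u,t)$. Then there is a randomized $O(1)$-round algorithm and a deterministic $O(1)$-round algorithm, both depending only on $n$, $k$, $p$, $c$, such that w.h.p. the following holds. The randomized algorithm constructs a weighted undirected graph $G_S$, with positive integer edge weights polynomially bounded in $n$, over a subset $V_S\subseteq V$ of size $$|V_S| = O\!\left(\frac{n\log(k+1)}{k}\right);$$ each node learns whether it belongs to $V_S$ and learns its incident edges in $G_S$ with their weights. Moreover, for every real $l\ge 1$ and every $l$-approximation $\delta_{G_S}$ of APSP on $G_S$, if each node $s\in V_S$ is given the values $\delta_{G_S}(s,\cdot)$ on $V_S$, then the deterministic algorithm computes a $7la^2$-approximation of APSP on $G$. -/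

import Mathlib

open scoped ENNReal

/-! ### Weighted graphs and distances -/

/-- A simple undirected graph with positive integer edge weights. The value of `weight` at a pair
that is not an edge plays no role. -/
structure WGraph (V : Type) where
  graph : SimpleGraph V
  weight : Sym2 V → ℕ
  weight_pos : ∀ e ∈ graph.edgeSet, 0 < weight e

namespace WGraph

variable {V : Type}

/-- The weighted distance: the least total weight of a walk from `u` to `v`, and `⊤` if there is
none. (Weights being positive, walks and paths give the same minimum.) -/
noncomputable def dist (G : WGraph V) (u v : V) : ℕ∞ :=
  ⨅ p : G.graph.Walk u v, (((p.edges.map G.weight).sum : ℕ) : ℕ∞)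

/-- All edge weights are at most `M`. -/
def WeightsLE (G : WGraph V) (M : ℕ) : Prop :=
  ∀ e ∈ G.graph.edgeSet, G.weight e ≤ M

/-- `G` is a graph over the node set `S`: both endpoints of every edge lie in `S`. -/
def IsOver (G : WGraph V) (S : Finset V) : Prop :=
  ∀ u v, G.graph.Adj u v → u ∈ S ∧ v ∈ S

open Classical in
/-- The incident edges of `v` together with their weights (`none` means that there is no edge). -/
noncomputable def incident (G : WGraph V) (v : V) : V → Option ℕ :=
  fun u => if G.graph.Adj v u then some (G.weight s(v, u)) else none

end WGraph

/-- `f` is an `α`-approximation of the distances `d` between the nodes of `S`: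
`d u v ≤ f u v ≤ α * d u v` for all `u, v ∈ S`. -/
def IsApproxOn {V : Type} (S : Finset V) (α : ℝ) (d : V → V → ℕ∞) (f : V → V → ℝ≥0∞) : Prop :=
  ∀ u ∈ S, ∀ v ∈ S, (d u v : ℝ≥0∞) ≤ f u v ∧ f u v ≤ ENNReal.ofReal α * (d u v : ℝ≥0∞)

/-! ### The congested clique -/

namespace CongestedClique

/-- A message: a string of `β * (⌊log₂ n⌋ + 1)` bits. -/
abbrev Msg (n β : ℕ) : Type := Fin (β * (Nat.log 2 n + 1)) → Bool

/-- A deterministic algorithm for the congested clique on the nodes `Fin n`, with local inputs in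
`In` and local outputs in `Out`. In a round every node sends one message to every node, as a
function of its own local state, and then updates its state from the messages it received. Local
computation is unrestricted; every node knows its own identifier and `n`. -/
structure Algorithm (n β : ℕ) (In Out : Type) where
  State : Type
  init : Fin n → In → State
  /-- `send u s v` is the message from `u`, in state `s`, to `v`. -/
  send : Fin n → State → Fin n → Msg n β
  /-- `step v s m` is the new state of `v` when `m u` is the message received from `u`. -/
  step : Fin n → State → (Fin n → Msg n β) → State
  output : Fin n → State → Out

namespace Algorithm

variable {n β : ℕ} {In Out : Type}

/-- The local states after a given number of rounds, on the local inputs `x`. -/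
def stateAfter (A : Algorithm n β In Out) (x : Fin n → In) : ℕ → Fin n → A.State
  | 0 => fun v => A.init v (x v)
  | R + 1 => fun v => A.step v (A.stateAfter x R v) (fun u => A.send u (A.stateAfter x R u) v)

/-- The local outputs when `A` is run for `R` rounds on the local inputs `x`. -/
def run (A : Algorithm n β In Out) (R : ℕ) (x : Fin n → In) (v : Fin n) : Out :=
  A.output v (A.stateAfter x R v)

end Algorithm

/-- The probability of `P` when each of the `n` nodes independently draws `r` private uniformly
random bits; `ω v` are the bits of node `v`. -/
noncomputable def coinProb (n r : ℕ) (P : (Fin n → Fin r → Bool) → Prop) : ℝ :=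
  (Nat.card {ω : Fin n → Fin r → Bool // P ω} : ℝ) / (Nat.card (Fin n → Fin r → Bool) : ℝ)

end CongestedClique

/-! ### Approximate nearest sets and local inputs and outputs -/

/-- The sets `N u` are approximate nearest sets and `δ` is a local `a`-approximation of the
distances of `G`, that is,
* `d u v ≤ δ u v ≤ a * d u v` for all `v ∈ N u`, and
* `δ u v ≤ a * d u t` for all `v ∈ N u` and `t ∉ N u`.

(The first inequality forces `δ u v` to be nonnegative, so that it may be read as a natural number;
it also forces `d u v` to be finite.) -/
structure IsLocalApprox {V : Type} (G : WGraph V) (a : ℝ) (δ : V → V → ℤ) (N : V → Finset V) :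
    Prop where
  nonneg : ∀ u, ∀ v ∈ N u, 0 ≤ δ u v
  lower : ∀ u, ∀ v ∈ N u, (G.dist u v : ℝ≥0∞) ≤ ((δ u v).toNat : ℝ≥0∞)
  upper : ∀ u, ∀ v ∈ N u, ((δ u v).toNat : ℝ≥0∞) ≤ ENNReal.ofReal a * (G.dist u v : ℝ≥0∞)
  far : ∀ u, ∀ v ∈ N u, ∀ t, t ∉ N u →
    ((δ u v).toNat : ℝ≥0∞) ≤ ENNReal.ofReal a * (G.dist u t : ℝ≥0∞)

/-- What a node knows initially: its incident edges, its approximate nearest set, and the value of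
`δ` at the members of that set only. -/
structure LocalInput (n : ℕ) where
  edges : Fin n → Option ℕ
  near : Finset (Fin n)
  est : Fin n → Option ℤ

/-- The local input of the node `v`. -/
noncomputable def localInput {n : ℕ} (G : WGraph (Fin n)) (δ : Fin n → Fin n → ℤ)
    (N : Fin n → Finset (Fin n)) (v : Fin n) : LocalInput n where
  edges := G.incident v
  near := N v
  est := fun u => if u ∈ N v then some (δ v u) else none

/-- What a node knows about a skeleton graph: whether it is a node of it, and its incident edges
in it. -/
structure LocalSkeleton (n : ℕ) where
  isNode : Bool
  edges : Fin n → Option ℕ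

/-- The local view, at node `v`, of the weighted graph `H` over the node set `S`. -/
noncomputable def localSkeleton {n : ℕ} (S : Finset (Fin n)) (H : WGraph (Fin n)) (v : Fin n) :
    LocalSkeleton n where
  isNode := decide (v ∈ S)
  edges := H.incident v

/-- What node `v` is given of distance estimates `D` between the nodes of `S`: its own row if
`v ∈ S`, and nothing otherwise. -/
noncomputable def distRow {n : ℕ} (S : Finset (Fin n)) (D : Fin n → Fin n → ℝ≥0∞) (v : Fin n) :
    Fin n → Option ℝ≥0∞ :=
  fun u => if v ∈ S ∧ u ∈ S then some (D v u) else none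

/-! Sample every node with probability `1 / 2 ^ j`, about `log (k + 1) / k`, and let the hubs `S` be
the sampled nodes together with all nodes whose near set was missed (`cover`). Every near set
contains its owner, so every near set meets `S`. The hub of `x` is the first node of `S` in its near
set, `rad` the estimate to it, and the ball of `x` the near set up to the hub. The expected number
of hubs is at most `4 * n * log (k + 1) / k`, and a geometric series bounds the expected total size
of the balls by `n * k / log (k + 1)`. By Markov, one trial is good with probability at least one
half (`card_bad_le`). Running `c * (log n + 1)` independent trials in parallel and agreeing on a
verified good one gives failure probability at most `1 / n ^ c` (`coinProb_ge`, `next_sample`).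

Two hubs `s`, `s'` are joined with the length of the best connection s - x - z - y - s', where `x`
has hub `s`, `z` lies in the ball of `x`, the step from `z` to `y` is an edge or trivial, and `y`
has hub `s'`. In a good trial the number of hubs times the total ball size is at most `64 * n ^ 2`.
Hence every hub can be given enough workers to inspect all pairs `(x, z)` with a constant number of
pairs per link (`IsGood.le_mul`, `collect_eq_cost`).

For the stretch, cut a walk at the first edge leaving the ball of its current node. The radius of
that node is at most `a` times the segment up to and including this edge, so the detour through the
hubs can be charged to the segment (`exists_skeleton_bound`). If `u` is not near `v`, the radius of
`v` is also at most `a` times the walk, and the total is at most `l * (5 * a + 2 * a ^ 2) ≤ 7 * l *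
a ^ 2` times its length (`skeleton_approx`). If it is near, the given estimate suffices. -/

namespace CongestedClique

/-! ### Programs as trees of rounds -/

/-- The behaviour of one node: either it has an output, or it sends messages and continues
depending on the messages it receives. -/
inductive Prog (n β : ℕ) (Out : Type) : Type
  | ret (o : Out) : Prog n β Out
  | round (m : Fin n → Msg n β) (k : (Fin n → Msg n β) → Prog n β Out) : Prog n β Out

namespace Prog

variable {n β : ℕ} {In Out T : Type}

/-- The messages sent next. -/
def msg : Prog n β Out → Fin n → Msg n β
  | ret _ => fun _ _ => false
  | round m _ => m

/-- The behaviour after receiving messages. -/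
def step : Prog n β Out → (Fin n → Msg n β) → Prog n β Out
  | ret o => fun _ => ret o
  | round _ k => k

/-- The output, if there is one. -/
def out [Inhabited Out] : Prog n β Out → Out
  | ret o => o
  | round _ _ => default

/-- One synchronous round of a system of programs. -/
def next (P : Fin n → Prog n β Out) : Fin n → Prog n β Out :=
  fun v => (P v).step fun u => (P u).msg v

/-- The algorithm in which node `v` with input `x` runs the program `P v x`. -/
def toAlgorithm [Inhabited Out] (P : Fin n → In → Prog n β Out) : Algorithm n β In Out where
  State := Prog n β Out
  init := P
  send _ s v := s.msg v
  step _ s m := s.step m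
  output _ s := s.out

theorem stateAfter_toAlgorithm [Inhabited Out] (P : Fin n → In → Prog n β Out) (x : Fin n → In)
    (R : ℕ) : (toAlgorithm P).stateAfter x R = next^[R] fun v => P v (x v) := by
  induction R with
  | zero => rfl
  | succ R ih =>
    rw [Function.iterate_succ_apply', ← ih]
    rfl

theorem run_toAlgorithm [Inhabited Out] (P : Fin n → In → Prog n β Out) (x : Fin n → In)
    (R : ℕ) (v : Fin n) :
    (toAlgorithm P).run R x v = ((next^[R] fun v => P v (x v)) v).out := by
  rw [← stateAfter_toAlgorithm]
  rfl

end Prog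

/-! ### Types that fit into messages of logarithmic size -/

/-- `T` has at most `2 ^ (b * (⌊log₂ n⌋ + 1))` elements. -/
def Fits (n b : ℕ) (T : Type) : Prop :=
  Finite T ∧ Nat.card T ≤ (2 ^ (Nat.log 2 n + 1)) ^ b

open Classical in
/-- An encoding of the elements of `T` by messages, injective if `T` is small enough. -/
noncomputable def enc (n β : ℕ) (T : Type) : T → Msg n β :=
  if h : Nonempty (T ↪ Msg n β) then h.some else fun _ _ => false

open Classical in
/-- A left inverse of `enc`. -/
noncomputable def dec (n β : ℕ) (T : Type) [Nonempty T] : Msg n β → T :=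
  Function.invFun (enc n β T)

section Fits

variable {n b b' : ℕ} {T T' : Type}

theorem dec_enc [Nonempty T] (h : Fits n b T) (x : T) : dec n b T (enc n b T x) = x := by
  have hf := h.1
  have hne : Nonempty (T ↪ Msg n b) := by
    have := Fintype.ofFinite T
    refine Function.Embedding.nonempty_of_card_le ?_
    have := h.2
    rw [Nat.card_eq_fintype_card] at this
    rw [Fintype.card_fun, Fintype.card_bool, Fintype.card_fin, mul_comm, pow_mul]
    exact this
  have hinj : Function.Injective (enc n b T) := by
    rw [enc, dif_pos hne]
    exact hne.some.injective
  exact Function.leftInverse_invFun hinj x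

theorem two_le_base (n : ℕ) : 2 ≤ 2 ^ (Nat.log 2 n + 1) := by
  rw [pow_succ]
  have := Nat.one_le_two_pow (n := Nat.log 2 n)
  omega

theorem lt_base (n : ℕ) : n < 2 ^ (Nat.log 2 n + 1) := Nat.lt_pow_succ_log_self (by norm_num) n

theorem Fits.mono (h : Fits n b T) (hb : b ≤ b') : Fits n b' T :=
  ⟨h.1, h.2.trans (Nat.pow_le_pow_right (by have := two_le_base n; omega) hb)⟩

theorem Fits.prod (h : Fits n b T) (h' : Fits n b' T') : Fits n (b + b') (T × T') := by
  have := h.1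
  have := h'.1
  refine ⟨inferInstance, ?_⟩
  rw [Nat.card_prod, pow_add]
  exact Nat.mul_le_mul h.2 h'.2

theorem Fits.option (h : Fits n b T) : Fits n (b + 1) (Option T) := by
  have := h.1
  refine ⟨inferInstance, ?_⟩
  rw [Finite.card_option, pow_succ]
  have h1 := two_le_base n
  have h2 : 1 ≤ (2 ^ (Nat.log 2 n + 1)) ^ b := Nat.one_le_pow _ _ (by omega)
  have h3 := h.2
  nlinarith

theorem Fits.pi (h : Fits n b T) (m : ℕ) : Fits n (b * m) (Fin m → T) := by
  have := h.1
  refine ⟨inferInstance, ?_⟩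
  rw [Nat.card_fun, Nat.card_eq_fintype_card (α := Fin m), Fintype.card_fin, pow_mul]
  exact Nat.pow_le_pow_left h.2 m

theorem fits_bool (n : ℕ) : Fits n 1 Bool := by
  refine ⟨inferInstance, ?_⟩
  simpa using two_le_base n

theorem fits_fin (n : ℕ) : Fits n 1 (Fin n) := by
  refine ⟨inferInstance, ?_⟩
  simpa using (lt_base n).le

theorem fits_fin_succ (n : ℕ) : Fits n 1 (Fin (n + 1)) := by
  refine ⟨inferInstance, ?_⟩
  simpa using lt_base n

theorem fits_trials (n c : ℕ) : Fits n c (Fin c × Fin (Nat.log 2 n + 1) → Bool) := by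
  refine ⟨inferInstance, ?_⟩
  simp [← pow_mul, mul_comm]

/-- Distances up to `K`, or infinity. -/
abbrev Val (K : ℕ) : Type := Option (Fin (K + 1))

theorem fits_val (n m K : ℕ) (hK : K ≤ 4 * n ^ m) : Fits n (m + 4) (Val K) := by
  have h1 := two_le_base n
  have h2 : n ^ m ≤ (2 ^ (Nat.log 2 n + 1)) ^ m := Nat.pow_le_pow_left (lt_base n).le m
  have h3 : 1 ≤ (2 ^ (Nat.log 2 n + 1)) ^ m := Nat.one_le_pow _ _ (by omega)
  refine Fits.option (b := m + 3) ⟨inferInstance, ?_⟩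
  have h4 : 2 ^ 3 ≤ (2 ^ (Nat.log 2 n + 1)) ^ 3 := Nat.pow_le_pow_left h1 3
  rw [Nat.card_eq_fintype_card, Fintype.card_fin, pow_add]
  nlinarith

end Fits

namespace Prog

variable {n β : ℕ} {Out T : Type}

/-- Send a value of type `T` to every node and continue with the values received. -/
noncomputable def exchange [Nonempty T] (m : Fin n → T) (k : (Fin n → T) → Prog n β Out) :
    Prog n β Out :=
  round (fun u => enc n β T (m u)) fun ms => k fun u => dec n β T (ms u)

theorem next_exchange [Nonempty T] (h : Fits n β T) (m : Fin n → Fin n → T)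
    (k : Fin n → (Fin n → T) → Prog n β Out) :
    next (fun v => exchange (m v) (k v)) = fun v => k v fun u => m u v := by
  funext v
  simp only [next, exchange, step, msg, dec_enc h]

end Prog

/-! ### Bounded distances as message contents -/

section Val

open Classical in
/-- Encode a distance; finite values above `K` are replaced by infinity. -/
noncomputable def toVal (K : ℕ) (x : ℕ∞) : Val K :=
  if h : x ≤ K then some ⟨x.toNat, Nat.lt_succ_of_le (ENat.toNat_le_of_le_natCast h)⟩ else none

/-- Decode a distance. -/
def ofVal {K : ℕ} : Val K → ℕ∞
  | none => ⊤
  | some x => ((x : ℕ) : ℕ∞)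

/-- `x` is infinite or at most `K`. -/
def Capped (K : ℕ) (x : ℕ∞) : Prop := x = ⊤ ∨ x ≤ K

theorem ofVal_toVal {K : ℕ} {x : ℕ∞} (h : Capped K x) : ofVal (toVal K x) = x := by
  unfold toVal
  split_ifs with h1
  · have : x ≠ ⊤ := fun h => by simp [h] at h1
    simp [ofVal, ENat.natCast_toNat this]
  · rcases h with h | h
    · simp [ofVal, h]
    · exact absurd h h1

theorem Capped.iInf {K : ℕ} {ι : Sort*} {f : ι → ℕ∞} (h : ∀ i, Capped K (f i)) :
    Capped K (⨅ i, f i) := by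
  by_cases hi : ∃ i, f i ≤ K
  · obtain ⟨i, hi⟩ := hi
    exact Or.inr ((iInf_le f i).trans hi)
  · left
    rw [iInf_eq_top]
    exact fun i => (h i).resolve_right fun h => hi ⟨i, h⟩

theorem Capped.coe {K m : ℕ} (h : m ≤ K) : Capped K (m : ℕ∞) := Or.inr (by exact_mod_cast h)

theorem Capped.mono {K K' : ℕ} {x : ℕ∞} (h : Capped K x) (hK : K ≤ K') : Capped K' x :=
  h.imp_right fun h => h.trans (by exact_mod_cast hK)

theorem Capped.add {K K' : ℕ} {x y : ℕ∞} (hx : Capped K x) (hy : Capped K' y) :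
    Capped (K + K') (x + y) := by
  rcases hx with rfl | hx
  · exact Or.inl (top_add _)
  · rcases hy with rfl | hy
    · exact Or.inl (add_top _)
    · right
      push_cast
      exact add_le_add hx hy

end Val

/-! ### Hubs, radii and balls -/

section Local

variable {n : ℕ} (M : ℕ) (I : LocalInput n) (S : Finset (Fin n)) (v : Fin n)

/-- The distance estimate for `z`, capped at `M`. -/
def val (z : Fin n) : ℕ := min ((I.est z).getD 0).toNat M

/-- Nodes ordered by their distance estimates, with ties broken by identifiers. -/
def key (z : Fin n) : ℕ := val M I z * n + z

open Classical in
/-- The node of `S` that comes first in the near set of `v`. -/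
noncomputable def hub : Fin n :=
  if h : (I.near ∩ S).Nonempty then (Finset.exists_min_image _ (key M I) h).choose else v

/-- The distance estimate for the hub. -/
noncomputable def rad : ℕ := val M I (hub M I S v)

/-- The part of the near set up to the hub. -/
noncomputable def ball : Finset (Fin n) :=
  I.near.filter fun z => key M I z ≤ key M I (hub M I S v)

open Classical in
/-- The length of a step along an edge, or of no step. -/
noncomputable def hop (u : Fin n) : ℕ∞ :=
  if u = v then 0 else (I.edges u).elim ⊤ fun w => (w : ℕ∞)

theorem key_injective : Function.Injective (key M I) := by
  intro y z h
  have hn : 0 < n := y.pos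
  unfold key at h
  have h1 : (val M I y * n + y) % n = (val M I z * n + z) % n := by rw [h]
  rw [Nat.mul_add_mod', Nat.mul_add_mod', Nat.mod_eq_of_lt y.2, Nat.mod_eq_of_lt z.2] at h1
  exact Fin.ext h1

theorem val_le_of_key_le {y z : Fin n} (h : key M I y ≤ key M I z) : val M I y ≤ val M I z := by
  by_contra! h1
  have h2 : (val M I z + 1) * n ≤ val M I y * n := Nat.mul_le_mul_right _ h1
  unfold key at h
  have := z.2
  nlinarith

variable {S} in
theorem hub_spec (h : (I.near ∩ S).Nonempty) : hub M I S v ∈ I.near ∩ S ∧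
    ∀ z ∈ I.near ∩ S, key M I (hub M I S v) ≤ key M I z := by
  rw [hub, dif_pos h]
  exact (Finset.exists_min_image _ (key M I) h).choose_spec

theorem ball_subset : ball M I S v ⊆ I.near := Finset.filter_subset _ _

theorem val_le : val M I v ≤ M := min_le_right _ _

theorem rad_le : rad M I S v ≤ M := val_le _ _ _

theorem rad_le_of_notMem_ball {z : Fin n} (hz : z ∈ I.near) (h : z ∉ ball M I S v) :
    rad M I S v ≤ val M I z := by
  refine val_le_of_key_le M I ?_
  by_contra! h1
  exact h (Finset.mem_filter.2 ⟨hz, h1.le⟩)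

end Local

/-! ### Distributing ball members to workers -/

section Routing

variable {n : ℕ} (κ : Fin n → ℕ)

/-- The position of the first item of `x` when node `y` has `κ y` items. -/
def offset (x : Fin n) : ℕ := ∑ y ∈ Finset.univ.filter (· < x), κ y

variable {κ}

theorem offset_add_le {x y : Fin n} (h : x < y) : offset κ x + κ x ≤ offset κ y := by
  have : insert x (Finset.univ.filter (· < x)) ⊆ Finset.univ.filter (· < y) := by
    intro z hz
    simp only [Finset.mem_insert, Finset.mem_filter, Finset.mem_univ, true_and] at hz ⊢
    rcases hz with rfl | hz
    · exact h
    · exact hz.trans h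
  have h2 := Finset.sum_le_sum_of_subset (f := κ) this
  rw [Finset.sum_insert (by simp)] at h2
  unfold offset
  omega

theorem offset_add_lt {x : Fin n} {i : ℕ} (hi : i < κ x) : offset κ x + i < ∑ y, κ y := by
  have h2 := Finset.sum_le_sum_of_subset (f := κ)
    (Finset.subset_univ (insert x (Finset.univ.filter (· < x))))
  rw [Finset.sum_insert (by simp)] at h2
  unfold offset
  omega

theorem offset_add_inj {x y : Fin n} {i j : ℕ} (hi : i < κ x) (hj : j < κ y)
    (h : offset κ x + i = offset κ y + j) : x = y ∧ i = j := by
  rcases lt_trichotomy x y with hxy | rfl | hxy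
  · have := offset_add_le (κ := κ) hxy
    omega
  · exact ⟨rfl, by omega⟩
  · have := offset_add_le (κ := κ) hxy
    omega

variable (κ) {α : Type}

open Classical in
/-- The item that `x` hands to the helper `q`: positions are distributed cyclically. -/
noncomputable def handout (items : List α) (x q : Fin n) : Option α :=
  if h : ∃ i, i < κ x ∧ (offset κ x + i) % n = q then items[h.choose]? else none

open Classical in
/-- The item at position `e` together with its owner, if the items handed to the present helper
are `got`. -/
noncomputable def itemAt (got : Fin n → Option α) (e : ℕ) : Option (Fin n × α) :=
  if h : ∃ x i, i < κ x ∧ offset κ x + i = e then (got h.choose).map fun a => (h.choose, a)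
  else none

variable {κ}

theorem handout_mem {items : List α} {x q : Fin n} {a : α} (h : handout κ items x q = some a) :
    a ∈ items := by
  unfold handout at h
  split_ifs at h with h1
  exact List.mem_of_getElem? h

/-- The items of `x` occupy at most `n` consecutive positions, which have distinct residues modulo
`n`. So `x` hands at most one item to each helper, and one message suffices. -/
theorem handout_eq {items : List α} {x q : Fin n} {i : ℕ} (hi : i < κ x) (hx : κ x ≤ n)
    (hq : (offset κ x + i) % n = q) : handout κ items x q = items[i]? := by
  have h : ∃ i, i < κ x ∧ (offset κ x + i) % n = q := ⟨i, hi, hq⟩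
  rw [handout, dif_pos h]
  have h1 := h.choose_spec
  congr 1
  have h2 : (offset κ x + h.choose) ≡ (offset κ x + i) [MOD n] := h1.2.trans hq.symm
  exact Nat.ModEq.eq_of_lt_of_lt (Nat.ModEq.add_left_cancel' _ h2) (h1.1.trans_le hx)
    (hi.trans_le hx)

theorem itemAt_some {got : Fin n → Option α} {e : ℕ} {x : Fin n} {a : α}
    (h : itemAt κ got e = some (x, a)) : got x = some a := by
  unfold itemAt at h
  split_ifs at h with h1
  rw [Option.map_eq_some_iff] at h
  obtain ⟨b, hb, hb'⟩ := h
  rw [Prod.mk.injEq] at hb'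
  rw [← hb'.1, ← hb'.2, hb]

theorem itemAt_eq {got : Fin n → Option α} {x : Fin n} {i : ℕ} (hi : i < κ x) :
    itemAt κ got (offset κ x + i) = (got x).map fun a => (x, a) := by
  have h : ∃ y j, j < κ y ∧ offset κ y + j = offset κ x + i := ⟨x, i, hi, rfl⟩
  rw [itemAt, dif_pos h]
  obtain ⟨j, hj, hj'⟩ := h.choose_spec
  rw [(offset_add_inj hj hi hj').1]

/-- The block of positions that worker `w` is responsible for when there are `m` columns. -/
def block (m : ℕ) (w : Fin n) : ℕ := (w : ℕ) / m

/-- The column, in `S`, that worker `w` is responsible for. -/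
noncomputable def column (S : Finset (Fin n)) (w : Fin n) : Option (Fin n) :=
  S.toList[(w : ℕ) % S.card]?

theorem exists_worker {S : Finset (Fin n)} {s : Fin n} (hs : s ∈ S) {j : ℕ}
    (hj : j < n / S.card) : ∃ w : Fin n, block S.card w = j ∧ column S w = some s := by
  obtain ⟨i, hi, his⟩ := List.mem_iff_getElem.1 (Finset.mem_toList.2 hs)
  rw [Finset.length_toList] at hi
  have h1 : (j + 1) * S.card ≤ n :=
    (Nat.mul_le_mul_right _ hj).trans (Nat.div_mul_le_self _ _)
  have hw : j * S.card + i < n := by nlinarith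
  refine ⟨⟨j * S.card + i, hw⟩, ?_, ?_⟩
  · simp only [block]
    rw [mul_comm, Nat.mul_add_div (by omega), Nat.div_eq_of_lt hi, add_zero]
  · simp only [column]
    rw [mul_comm, Nat.mul_add_mod, Nat.mod_eq_of_lt hi, List.getElem?_eq_getElem (by simpa), his]

/-- The items that a helper passes to worker `w`. -/
noncomputable def shipment (κ : Fin n → ℕ) (S : Finset (Fin n)) (got : Fin n → Option α)
    (q w : Fin n) : Fin 128 → Option (Fin n × α) :=
  fun t => itemAt κ got ((block S.card w * 128 + t) * n + q)

/-- The item at position `e` sits with helper `e % n`, in row `e / n`. A worker of block `j`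
receives the 128 rows starting at `128 * j`, one item per row from each helper. The bound on the sum
says that the `n / S.card` blocks available for each column exhaust all rows. -/
theorem exists_shipment {S : Finset (Fin n)} {s : Fin n} (hs : s ∈ S)
    (hκ : ∀ x, κ x ≤ n) (hsum : ∑ x, κ x ≤ n / S.card * 128 * n)
    (items : Fin n → List α) (hitems : ∀ x, (items x).length = κ x)
    {x : Fin n} {a : α} (ha : a ∈ items x) :
    ∃ (q w : Fin n) (t : Fin 128), column S w = some s ∧
      shipment κ S (fun x => handout κ (items x) x q) q w t = some (x, a) := by
  have hn : 0 < n := x.pos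
  obtain ⟨i, hi, hia⟩ := List.mem_iff_getElem.1 ha
  rw [hitems] at hi
  set e := offset κ x + i with he
  have helt : e < ∑ y, κ y := offset_add_lt hi
  have hrow : e / n < n / S.card * 128 := Nat.div_lt_of_lt_mul (by rw [mul_comm]; omega)
  have hblock : e / n / 128 < n / S.card := Nat.div_lt_of_lt_mul (by omega)
  obtain ⟨w, hw, hws⟩ := exists_worker hs hblock
  refine ⟨⟨e % n, Nat.mod_lt _ hn⟩, w, ⟨e / n % 128, Nat.mod_lt _ (by norm_num)⟩, hws, ?_⟩
  have h1 : (block S.card w * 128 + e / n % 128) * n + e % n = e := by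
    rw [hw, Nat.div_add_mod' (e / n) 128, Nat.div_add_mod']
  simp only [shipment]
  rw [h1, he, itemAt_eq hi, handout_eq hi (hκ x) rfl,
    List.getElem?_eq_getElem (by rw [hitems]; exact hi), hia]
  rfl

theorem shipment_some {S : Finset (Fin n)} {items : Fin n → List α} {q w x : Fin n} {t : Fin 128}
    {a : α} (h : shipment κ S (fun x => handout κ (items x) x q) q w t = some (x, a)) :
    a ∈ items x :=
  handout_mem (itemAt_some (got := fun x => handout κ (items x) x q) h)

end Routing

instance {n : ℕ} : Inhabited (LocalSkeleton n) := ⟨⟨false, fun _ => none⟩⟩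

/-! ### Construction of the skeleton graph in five rounds -/

section Build

variable {n : ℕ} (M K : ℕ)

/-- The length of a shortest connection from `z` to the hub `s`, by at most one edge followed by
the radius of the node reached. -/
noncomputable def reach (hb : Fin n → Fin n) (rd : Fin n → ℕ∞) (I : LocalInput n) (z s : Fin n) :
    ℕ∞ :=
  ⨅ (y) (_ : hb y = s), hop I z y + rd y

/-- What a worker finds for the hub `s` from the items `(x, z, c)` and the values `g z`. -/
noncomputable def partialCost (hb : Fin n → Fin n) (rd : Fin n → ℕ∞)
    (items : Fin n → Fin 128 → Option (Fin n × Fin n × Val K)) (g : Fin n → ℕ∞) (s : Fin n) : ℕ∞ :=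
  ⨅ (q) (t) (x) (z) (c) (_ : items q t = some (x, z, c)) (_ : hb x = s), rd x + (ofVal c + g z)

/-- The minimum over the workers for the hub `s`. -/
noncomputable def collect (S : Finset (Fin n)) (f : Fin n → ℕ∞) (s : Fin n) : ℕ∞ :=
  ⨅ (w) (_ : column S w = some s), f w

open Classical in
/-- The edge between `v` and `u` in the skeleton graph, given its weight. -/
noncomputable def skeletonEdge (S : Finset (Fin n)) (v u : Fin n) (c : ℕ∞) : Option ℕ :=
  if v ≠ u ∧ v ∈ S ∧ u ∈ S ∧ c ≠ ⊤ then some c.toNat else none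

/-- The length of a shortest connection between hubs `s` and `s'` through the ball of a node with
hub `s`, at most one edge, and a node with hub `s'`. -/
noncomputable def cost (I : Fin n → LocalInput n) (S : Finset (Fin n)) (s s' : Fin n) : ℕ∞ :=
  ⨅ (x) (_ : hub M (I x) S x = s) (z) (_ : z ∈ ball M (I x) S x),
    (rad M (I x) S x : ℕ∞) + (val M (I x) z +
      reach (fun y => hub M (I y) S y) (fun y => rad M (I y) S y) (I z) z s')

/-- The construction of the skeleton graph over `S`, as a program for node `v`. -/
noncomputable def build [Nonempty (Fin n)] (β : ℕ) (v : Fin n) (I : LocalInput n)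
    (S : Finset (Fin n)) : Prog n β (LocalSkeleton n) :=
  .exchange (T := Fin n × Val K × Fin (n + 1))
    (fun _ => (hub M I S v, toVal K (rad M I S v),
      Fin.ofNat (n + 1) (ball M I S v).card)) fun info =>
  .exchange (T := Option (Fin n × Val K))
    (fun q => handout (fun x => (info x).2.2)
      ((ball M I S v).toList.map fun z => (z, toVal K (val M I z))) v q) fun got =>
  .exchange (T := (Fin 128 → Option (Fin n × Fin n × Val K)) × Val K)
    (fun w => (shipment (fun x => (info x).2.2) S got v w, toVal K ((column S w).elim ⊤ fun s =>
      reach (fun y => (info y).1) (fun y => ofVal (info y).2.1) I v s))) fun ship =>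
  .exchange (T := Val K)
    (fun s => toVal K (partialCost K (fun y => (info y).1) (fun y => ofVal (info y).2.1)
      (fun q => (ship q).1) (fun z => ofVal (ship z).2) s)) fun part =>
  .exchange (T := Val K)
    (fun u => toVal K (collect S (fun w => ofVal (part w)) u)) fun W =>
  .ret ⟨decide (v ∈ S), fun u => skeletonEdge S v u
    (min (collect S (fun w => ofVal (part w)) u) (ofVal (W u)))⟩

theorem capped_hop {I : LocalInput n} {v : Fin n} (h : ∀ u w, I.edges u = some w → w ≤ M)
    (u : Fin n) : Capped M (hop I v u) := by
  unfold hop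
  split_ifs
  · exact Or.inr zero_le
  · rcases hu : I.edges u with _ | w
    · exact Or.inl rfl
    · exact Capped.coe (h u w hu)

theorem capped_reach {hb : Fin n → Fin n} {rd : Fin n → ℕ∞} (hrd : ∀ y, Capped M (rd y))
    {I : LocalInput n} {z : Fin n} (h : ∀ u w, I.edges u = some w → w ≤ M) (s : Fin n) :
    Capped (M + M) (reach hb rd I z s) :=
  .iInf fun y => .iInf fun _ => (capped_hop M h y).add (hrd y)

theorem capped_partialCost {hb : Fin n → Fin n} {rd : Fin n → ℕ∞}
    {items : Fin n → Fin 128 → Option (Fin n × Fin n × Val K)} {g : Fin n → ℕ∞} {s : Fin n}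
    (hrd : ∀ y, Capped M (rd y)) (hg : ∀ z, Capped (M + M) (g z))
    (hc : ∀ q t x z c, items q t = some (x, z, c) → Capped M (ofVal c)) :
    Capped (4 * M) (partialCost K hb rd items g s) := by
  refine .iInf fun q => .iInf fun t => .iInf fun x => .iInf fun z => .iInf fun c =>
    .iInf fun h => .iInf fun _ => ?_
  exact ((hrd x).add ((hc q t x z c h).add (hg z))).mono (by omega)

/-- Nodes outside `S` may collect meaningless values, since no worker has their column; these values
never enter an edge. -/
theorem skeletonEdge_congr {S : Finset (Fin n)} {v u : Fin n} {c c' : ℕ∞}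
    (h : v ∈ S → u ∈ S → c = c') : skeletonEdge S v u c = skeletonEdge S v u c' := by
  by_cases hv : v ∈ S
  · by_cases hu : u ∈ S
    · rw [h hv hu]
    · simp [skeletonEdge, hu]
  · simp [skeletonEdge, hv]

/-- One inequality needs that each pair `(x, z)` reaches some worker of column `s'`; the other needs
that workers only see genuine pairs. Repeated or missing items elsewhere do not affect a minimum. -/
theorem collect_eq_cost {I : Fin n → LocalInput n} {S : Finset (Fin n)} {s s' : Fin n}
    (hs' : s' ∈ S) (hM : M ≤ K)
    (hsum : ∑ x, (ball M (I x) S x).card ≤ n / S.card * 128 * n) :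
    collect S (fun w => partialCost K (fun y => hub M (I y) S y) (fun y => rad M (I y) S y)
      (fun q => shipment (fun y => (ball M (I y) S y).card) S
        (fun x => handout (fun y => (ball M (I y) S y).card)
          ((ball M (I x) S x).toList.map fun z => (z, toVal K (val M (I x) z))) x q) q w)
      (fun z => (column S w).elim ⊤ fun r =>
        reach (fun y => hub M (I y) S y) (fun y => rad M (I y) S y) (I z) z r) s) s' =
    cost M I S s s' := by
  have hval (x z : Fin n) : ofVal (toVal K (val M (I x) z)) = val M (I x) z :=
    ofVal_toVal (.coe ((val_le M (I x) z).trans hM))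
  apply le_antisymm
  · refine le_iInf fun x => le_iInf fun hx => le_iInf fun z => le_iInf fun hz => ?_
    obtain ⟨q, w, t, hw, ht⟩ := exists_shipment
      (items := fun x => (ball M (I x) S x).toList.map fun z => (z, toVal K (val M (I x) z)))
      hs' (fun x => (Finset.card_le_univ _).trans_eq (Fintype.card_fin n)) hsum
      (fun x => by simp) (x := x) (List.mem_map_of_mem (Finset.mem_toList.2 hz))
    refine (iInf₂_le w hw).trans ?_
    refine (iInf_le _ q).trans <| (iInf_le _ t).trans <| (iInf_le _ x).trans <|
      (iInf_le _ z).trans <| (iInf_le _ _).trans <| (iInf₂_le ht hx).trans ?_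
    rw [hval, hw]
    rfl
  · refine le_iInf fun w => le_iInf fun hw => le_iInf fun q => le_iInf fun t => le_iInf fun x =>
      le_iInf fun z => le_iInf fun c => le_iInf fun h => le_iInf fun hx => ?_
    have h1 := shipment_some (items := fun x => (ball M (I x) S x).toList.map
      fun z => (z, toVal K (val M (I x) z))) h
    obtain ⟨y, hy, hyz⟩ := List.mem_map.1 h1
    rw [Prod.mk.injEq] at hyz
    obtain ⟨rfl, rfl⟩ := hyz
    rw [hval, hw]
    exact (iInf₂_le x hx).trans (iInf₂_le y (Finset.mem_toList.1 hy))

/-- Connections have length at most `4 * M ≤ K` unless infinite, so no transmitted value is altered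
by its encoding. Node `v` collects `cost v u` for all `u`, and the last round supplies the reverse
`cost u v`, making weights symmetric. -/
theorem next_build [Nonempty (Fin n)] {β : ℕ} {I : Fin n → LocalInput n} {S : Finset (Fin n)}
    (h1 : Fits n β (Fin n × Val K × Fin (n + 1))) (h2 : Fits n β (Option (Fin n × Val K)))
    (h3 : Fits n β ((Fin 128 → Option (Fin n × Fin n × Val K)) × Val K)) (h4 : Fits n β (Val K))
    (hM : 4 * M ≤ K) (hedges : ∀ v u w, (I v).edges u = some w → w ≤ M)
    (hsum : ∑ x, (ball M (I x) S x).card ≤ n / S.card * 128 * n) :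
    Prog.next^[5] (fun v => build M K β v (I v) S) = fun v => .ret ⟨decide (v ∈ S),
      fun u => skeletonEdge S v u (min (cost M I S v u) (cost M I S u v))⟩ := by
  have hrad (y : Fin n) : Capped M (rad M (I y) S y) := .coe (rad_le M (I y) S y)
  have hrad' (y : Fin n) : ofVal (toVal K (rad M (I y) S y)) = rad M (I y) S y :=
    ofVal_toVal ((hrad y).mono (by omega))
  have hcard (y : Fin n) :
      ((Fin.ofNat (n + 1) (ball M (I y) S y).card : Fin (n + 1)) : ℕ) = (ball M (I y) S y).card :=
    Nat.mod_eq_of_lt (Nat.lt_succ_of_le ((Finset.card_le_univ _).trans_eq (Fintype.card_fin n)))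
  have hreach (w z : Fin n) : Capped (M + M) ((column S w).elim ⊤ fun r =>
        reach (fun y => hub M (I y) S y) (fun y => rad M (I y) S y) (I z) z r) := by
    rcases column S w with _ | r
    · exact Or.inl rfl
    · exact capped_reach M hrad (hedges z) r
  have hreach' (w z : Fin n) := ofVal_toVal ((hreach w z).mono (K' := K) (by omega))
  unfold build
  rw [Function.iterate_succ_apply, Prog.next_exchange h1, Function.iterate_succ_apply,
    Prog.next_exchange h2, Function.iterate_succ_apply, Prog.next_exchange h3,
    Function.iterate_succ_apply, Prog.next_exchange h4, Function.iterate_succ_apply,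
    Prog.next_exchange h4, Function.iterate_zero_apply]
  simp only [hrad', hcard, hreach']
  funext v
  congr 2
  funext u
  have hpart (w s : Fin n) := ofVal_toVal (K := K) (Capped.mono (capped_partialCost M K (s := s)
    (hb := fun y => hub M (I y) S y)
    (items := fun q => shipment (fun y => (ball M (I y) S y).card) S
        (fun x => handout (fun y => (ball M (I y) S y).card)
          ((ball M (I x) S x).toList.map fun z => (z, toVal K (val M (I x) z))) x q) q w)
          hrad (hreach w) (by
      intro q t x z c h
      have h1 := shipment_some (items := fun x => (ball M (I x) S x).toList.map
        fun z => (z, toVal K (val M (I x) z))) h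
      obtain ⟨y, hy, hyz⟩ := List.mem_map.1 h1
      rw [Prod.mk.injEq] at hyz
      rw [← hyz.2]
      have h2 : Capped M (val M (I x) y) := .coe (val_le M (I x) y)
      rwa [ofVal_toVal (h2.mono (by omega))])) hM)
  refine skeletonEdge_congr fun hv hu => ?_
  simp only [hpart]
  rw [collect_eq_cost M K hu (by omega) hsum, collect_eq_cost M K hv (by omega) hsum,
    ofVal_toVal]
  refine .iInf fun x => .iInf fun _ => .iInf fun z => .iInf fun _ => ?_
  refine Capped.mono ((hrad x).add (Capped.add (.coe (val_le M (I x) z))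
    (capped_reach M hrad (hedges z) v))) (by omega)

end Build
-- Parallel trials and agreement on a good one
/-- The indices of the sampling trials. -/
abbrev Trial (n c : ℕ) : Type := Fin c × Fin (Nat.log 2 n + 1)

section Sample

variable {n : ℕ}

open Classical in
/-- The set `U` together with the nodes whose near sets it misses. -/
noncomputable def cover (N : Fin n → Finset (Fin n)) (U : Finset (Fin n)) : Finset (Fin n) :=
  Finset.univ.filter fun u => u ∈ U ∨ Disjoint (N u) U

theorem cover_hits {N : Fin n → Finset (Fin n)} {U : Finset (Fin n)} {v : Fin n} (hv : v ∈ N v) :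
    (N v ∩ cover N U).Nonempty := by
  by_cases h : Disjoint (N v) U
  · exact ⟨v, Finset.mem_inter.2 ⟨hv, by simp [cover, h]⟩⟩
  · obtain ⟨u, hu, hu'⟩ := Finset.not_disjoint_iff.1 h
    exact ⟨u, Finset.mem_inter.2 ⟨hu, by simp [cover, hu']⟩⟩

/-- The total size of the balls when `S` is the set of hubs. -/
noncomputable def totalBall (M : ℕ) (I : Fin n → LocalInput n) (S : Finset (Fin n)) : ℕ :=
  ∑ x, (ball M (I x) S x).card

open Classical in
/-- The outcome of a trial that was reported as good. -/
noncomputable def select {c : ℕ} (f : Trial n c → Finset (Fin n)) (g : Fin n → Fin c → Bool) :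
    Finset (Fin n) :=
  if h : ∃ p : Fin n × Fin c, g p.1 p.2 = true then f (h.choose.2, Fin.ofNat _ h.choose.1) else ∅

/-- Node `m` supervises the trials `(i, m % (log n + 1))`. Since `log n < n`, each trial has a
supervisor. All nodes see the same reports `g`, so they choose the same trial. -/
theorem select_spec {c : ℕ} {f : Trial n c → Finset (Fin n)} {g : Fin n → Fin c → Bool}
    {P : Finset (Fin n) → Prop} (hg : ∀ m i, g m i = true ↔ P (f (i, Fin.ofNat _ m)))
    (h : ∃ τ, P (f τ)) [Nonempty (Fin n)] : ∃ τ, select f g = f τ ∧ P (f τ) := by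
  obtain ⟨⟨i, b⟩, hb⟩ := h
  have hn : n ≠ 0 := (Classical.arbitrary (Fin n)).pos.ne'
  have hbn : (b : ℕ) < n := (Nat.lt_succ_iff.1 b.2).trans_lt (Nat.log_lt_self 2 hn)
  have hmod : Fin.ofNat (Nat.log 2 n + 1) ((⟨b, hbn⟩ : Fin n) : ℕ) = b :=
    Fin.ext (Nat.mod_eq_of_lt b.2)
  have h : ∃ p : Fin n × Fin c, g p.1 p.2 = true :=
    ⟨(⟨b, hbn⟩, i), (hg _ _).2 (by rw [hmod]; exact hb)⟩
  exact ⟨_, by rw [select, dif_pos h], (hg _ _).1 h.choose_spec⟩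

open Classical in
/-- The agreement on the outcome of a good trial, as a program for node `v` that goes on with
`cont`. The outcomes of the trials are given by `bits`. -/
noncomputable def sample {Out : Type} [Nonempty (Fin n)] (M c β : ℕ)
    (good : Finset (Fin n) → ℕ → Prop) (v : Fin n) (I : LocalInput n) (bits : Trial n c → Bool)
    (cont : Finset (Fin n) → Prog n β Out) : Prog n β Out :=
  .exchange (T := Trial n c → Bool) (fun _ => bits) fun b =>
  .exchange (T := Trial n c → Bool)
    (fun _ τ => decide (Disjoint I.near (Finset.univ.filter fun u => b u τ = true))) fun h =>
  .exchange (T := Fin c → Fin (n + 1)) (fun m i => Fin.ofNat (n + 1) (ball M I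
    (Finset.univ.filter fun u => b u (i, Fin.ofNat _ m) = true ∨ h u (i, Fin.ofNat _ m) = true)
      v).card) fun cnt =>
  .exchange (T := Fin c → Bool) (fun _ i => decide (good
    (Finset.univ.filter fun u => b u (i, Fin.ofNat _ v) = true ∨ h u (i, Fin.ofNat _ v) = true)
      (∑ u, (cnt u i : ℕ)))) fun g =>
  cont (select (fun τ => Finset.univ.filter fun u => b u τ = true ∨ h u τ = true) g)

/-- The four rounds announce the sampled nodes, announce the missed near sets, send ball sizes to
the supervisors, and broadcast their verdicts. -/
theorem next_sample {Out : Type} [Nonempty (Fin n)] {M c β : ℕ}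
    {good : Finset (Fin n) → ℕ → Prop} {I : Fin n → LocalInput n} {bits : Fin n → Trial n c → Bool}
    (h1 : Fits n β (Trial n c → Bool)) (h2 : Fits n β (Fin c → Fin (n + 1)))
    (h3 : Fits n β (Fin c → Bool))
    (h : ∃ τ, good (cover (fun u => (I u).near) (Finset.univ.filter fun u => bits u τ = true))
      (totalBall M I (cover (fun u => (I u).near) (Finset.univ.filter fun u => bits u τ = true))))
    (cont : Fin n → Finset (Fin n) → Prog n β Out) :
    ∃ τ, ∃ S, S = cover (fun u => (I u).near) (Finset.univ.filter fun u => bits u τ = true) ∧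
      good S (totalBall M I S) ∧
      Prog.next^[4] (fun v => sample M c β good v (I v) (bits v) (cont v)) =
        fun v => cont v S := by
  classical
  have hcard (y : Fin n) (S : Finset (Fin n)) :
      ((Fin.ofNat (n + 1) (ball M (I y) S y).card : Fin (n + 1)) : ℕ) = (ball M (I y) S y).card :=
    Nat.mod_eq_of_lt (Nat.lt_succ_of_le ((Finset.card_le_univ _).trans_eq (Fintype.card_fin n)))
  have hcover (τ : Trial n c) : (Finset.univ.filter fun u => bits u τ = true ∨
      decide (Disjoint (I u).near (Finset.univ.filter fun u => bits u τ = true)) = true) =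
      cover (fun u => (I u).near) (Finset.univ.filter fun u => bits u τ = true) := by
    ext u
    simp [cover]
  have key := select_spec (n := n) (c := c)
    (f := fun τ => cover (fun u => (I u).near) (Finset.univ.filter fun u => bits u τ = true))
    (g := fun m i => decide (good
      (cover (fun u => (I u).near) (Finset.univ.filter fun u => bits u (i, Fin.ofNat _ m) = true))
      (totalBall M I (cover (fun u => (I u).near)
        (Finset.univ.filter fun u => bits u (i, Fin.ofNat _ m) = true)))))
    (P := fun S => good S (totalBall M I S)) (fun m i => by simp) h
  obtain ⟨τ, hτ, hgood⟩ := key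
  refine ⟨τ, _, rfl, hgood, ?_⟩
  unfold sample
  rw [Function.iterate_succ_apply, Prog.next_exchange h1, Function.iterate_succ_apply,
    Prog.next_exchange h1, Function.iterate_succ_apply, Prog.next_exchange h2,
    Function.iterate_succ_apply, Prog.next_exchange h3, Function.iterate_zero_apply]
  funext v
  simp only [hcard, hcover]
  rw [← hτ]
  rfl

end Sample

end CongestedClique

/-! ### Walks and weighted distances -/

namespace WGraph

variable {V : Type} (G : WGraph V)

/-- The total weight of a walk. -/
def walkWeight {u v : V} (p : G.graph.Walk u v) : ℕ := (p.edges.map G.weight).sum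

variable {G}

@[simp] theorem walkWeight_cons {u v w : V} (h : G.graph.Adj u v) (p : G.graph.Walk v w) :
    G.walkWeight (.cons h p) = G.weight s(u, v) + G.walkWeight p := by
  simp [walkWeight]

@[simp] theorem walkWeight_append {u v w : V} (p : G.graph.Walk u v) (q : G.graph.Walk v w) :
    G.walkWeight (p.append q) = G.walkWeight p + G.walkWeight q := by
  simp [walkWeight]

@[simp] theorem walkWeight_reverse {u v : V} (p : G.graph.Walk u v) :
    G.walkWeight p.reverse = G.walkWeight p := by
  simp [walkWeight]

theorem dist_le_walkWeight {u v : V} (p : G.graph.Walk u v) : G.dist u v ≤ G.walkWeight p :=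
  iInf_le (fun p : G.graph.Walk u v => (((p.edges.map G.weight).sum : ℕ) : ℕ∞)) p

theorem dist_le_natCast {u v : V} {m : ℕ} (h : G.dist u v ≤ m) :
    ∃ p : G.graph.Walk u v, G.walkWeight p ≤ m := by
  have h1 : G.dist u v < ((m + 1 : ℕ) : ℕ∞) :=
    h.trans_lt (by exact_mod_cast Nat.lt_succ_self m)
  obtain ⟨p, hp⟩ := iInf_lt_iff.1 h1
  exact ⟨p, Nat.lt_succ_iff.1 (by exact_mod_cast hp)⟩

theorem exists_walk_of_dist_ne_top {u v : V} (h : G.dist u v ≠ ⊤) :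
    ∃ p : G.graph.Walk u v, G.dist u v = G.walkWeight p := by
  obtain ⟨m, hm⟩ := ENat.ne_top_iff_exists.1 h
  obtain ⟨p, hp⟩ := dist_le_natCast hm.ge
  refine ⟨p, le_antisymm (dist_le_walkWeight p) ?_⟩
  rw [← hm]
  exact_mod_cast hp

theorem dist_self (u : V) : G.dist u u = 0 :=
  le_antisymm (dist_le_walkWeight (.nil : G.graph.Walk u u)) zero_le

theorem dist_comm (u v : V) : G.dist u v = G.dist v u := by
  have key (u v : V) : G.dist u v ≤ G.dist v u := by
    refine le_iInf fun p => ?_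
    have := dist_le_walkWeight p.reverse
    rwa [walkWeight_reverse] at this
  exact le_antisymm (key u v) (key v u)

theorem dist_triangle (u v w : V) : G.dist u w ≤ G.dist u v + G.dist v w := by
  by_cases h1 : G.dist u v = ⊤
  · simp [h1]
  by_cases h2 : G.dist v w = ⊤
  · simp [h2]
  obtain ⟨p, hp⟩ := exists_walk_of_dist_ne_top h1
  obtain ⟨q, hq⟩ := exists_walk_of_dist_ne_top h2
  have := dist_le_walkWeight (p.append q)
  rw [walkWeight_append] at this
  rw [hp, hq]
  exact_mod_cast this

theorem eq_of_dist_eq_zero {u v : V} (h : G.dist u v = 0) : u = v := by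
  obtain ⟨p, hp⟩ := dist_le_natCast (G := G) (u := u) (v := v) (m := 0) (by simp [h])
  cases p with
  | nil => rfl
  | cons e p =>
    have := G.weight_pos _ ((SimpleGraph.mem_edgeSet _).2 e)
    rw [walkWeight_cons] at hp
    omega

theorem dist_le_weight {u v : V} (h : G.graph.Adj u v) : G.dist u v ≤ G.weight s(u, v) := by
  have := dist_le_walkWeight h.toWalk
  simpa [SimpleGraph.Adj.toWalk, walkWeight] using this

/-- A walk from inside to outside of a set has an edge leaving it. -/
theorem exists_crossing {P : V → Prop} {u v : V} (p : G.graph.Walk u v) (hu : P u) (hv : ¬ P v) :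
    ∃ (z y : V) (_ : G.graph.Adj z y) (p₁ : G.graph.Walk u z) (p₂ : G.graph.Walk y v),
      P z ∧ ¬ P y ∧ G.walkWeight p₁ + G.weight s(z, y) + G.walkWeight p₂ = G.walkWeight p ∧
      p₂.length < p.length := by
  induction p with
  | nil => exact absurd hu hv
  | @cons u w v h p ih =>
    by_cases hw : P w
    · obtain ⟨z, y, hzy, p₁, p₂, hz, hy, hsum, hlen⟩ := ih hw hv
      refine ⟨z, y, hzy, .cons h p₁, p₂, hz, hy, ?_, ?_⟩
      · simp only [walkWeight_cons]
        omega
      · rw [SimpleGraph.Walk.length_cons]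
        omega
    · refine ⟨u, w, h, .nil, p, hu, hw, ?_, ?_⟩
      · simp [walkWeight]
      · simp

/-- Shortcutting a walk to a path leaves fewer than `n` edges. -/
theorem capped_dist {n K : ℕ} {G : WGraph (Fin n)} (hG : G.WeightsLE K) (u v : Fin n) :
    CongestedClique.Capped (n * K) (G.dist u v) := by
  classical
  by_cases h : G.dist u v = ⊤
  · exact Or.inl h
  right
  obtain ⟨p, -⟩ := exists_walk_of_dist_ne_top h
  refine (dist_le_walkWeight p.bypass).trans ?_
  have h1 : p.bypass.length < n := by
    simpa using (SimpleGraph.Walk.bypass_isPath p).length_lt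
  have h2 : G.walkWeight p.bypass ≤ p.bypass.length * K := by
    rw [walkWeight, ← SimpleGraph.Walk.length_edges]
    have := List.sum_le_card_nsmul (p.bypass.edges.map G.weight) K (by
      intro x hx
      obtain ⟨e, he, rfl⟩ := List.mem_map.1 hx
      exact hG e (p.bypass.edges_subset_edgeSet he))
    simpa using this
  exact_mod_cast h2.trans (Nat.mul_le_mul_right _ h1.le)

end WGraph

/-! ### Stretch of the skeleton graph -/

namespace CongestedClique

/-- The capped distance estimates `f x z`, for `z` in the near set of `x`, are a local
`a`-approximation. -/
structure Near {n : ℕ} (G : WGraph (Fin n)) (a : ℝ) (M : ℕ) (I : Fin n → LocalInput n) : Prop where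
  self_mem : ∀ x, x ∈ (I x).near
  edges : ∀ x, (I x).edges = G.incident x
  weights : G.WeightsLE M
  lower : ∀ x, ∀ z ∈ (I x).near, G.dist x z ≤ val M (I x) z
  upper : ∀ x, ∀ z ∈ (I x).near, ∀ p : G.graph.Walk x z, (val M (I x) z : ℝ) ≤ a * G.walkWeight p
  far : ∀ x, ∀ z ∈ (I x).near, ∀ t, t ∉ (I x).near → ∀ p : G.graph.Walk x t,
    (val M (I x) z : ℝ) ≤ a * G.walkWeight p

theorem toReal_bound {a : ℝ} (ha : 0 ≤ a) {m w : ℕ} {d : ℕ∞}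
    (h : (m : ℝ≥0∞) ≤ ENNReal.ofReal a * (d : ℝ≥0∞)) (hd : d ≤ w) : (m : ℝ) ≤ a * w := by
  have h1 : (m : ℝ≥0∞) ≤ ENNReal.ofReal (a * w) := by
    rw [ENNReal.ofReal_mul ha, ENNReal.ofReal_natCast]
    refine h.trans (mul_le_mul_right ?_ _)
    exact_mod_cast ENat.toENNReal_le.2 hd
  rw [← ENNReal.ofReal_natCast] at h1
  exact (ENNReal.ofReal_le_ofReal_iff (by positivity)).1 h1

/-- Finite distances are at most `n * n ^ p`, so capping the estimates at `n ^ (p + 1)` keeps the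
lower bound and can only help the upper bounds. -/
theorem near_localInput {n p k : ℕ} {G : WGraph (Fin n)} (hG : G.WeightsLE (n ^ p)) {a : ℝ}
    (ha : 1 ≤ a) {δ : Fin n → Fin n → ℤ} {N : Fin n → Finset (Fin n)} (hk : 1 ≤ k)
    (hN : ∀ u, (N u).card = k) (h : IsLocalApprox G a δ N) :
    Near G a (n ^ (p + 1)) fun v => localInput G δ N v := by
  have hval (x z : Fin n) (hz : z ∈ N x) :
      val (n ^ (p + 1)) (localInput G δ N x) z = min (δ x z).toNat (n ^ (p + 1)) := by
    simp [val, localInput, hz]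
  have ha0 : 0 ≤ a := by linarith
  constructor
  · intro x
    by_contra hx
    -- If `x` were outside its own near set, a member `z` would have estimate at most `a * d(x, x) =
    -- 0`. Positive weights then force `z = x`.
    obtain ⟨z, hz⟩ := Finset.card_pos.1 (by rw [hN x]; omega : 0 < (N x).card)
    have h1 := h.far x z hz x hx
    have h2 := h.lower x z hz
    rw [G.dist_self] at h1
    have h3 : G.dist x z = 0 := by
      have := h2.trans h1
      simpa using this
    exact hx (by rw [← WGraph.eq_of_dist_eq_zero h3] at hz; exact hz)
  · exact fun x => rfl
  · intro e he
    obtain ⟨u, v⟩ := e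
    exact (hG _ he).trans (Nat.pow_le_pow_right u.pos (Nat.le_succ p))
  · intro x z hz
    rw [hval x z hz]
    have h1 : G.dist x z ≤ ((δ x z).toNat : ℕ∞) := by
      have := h.lower x z hz
      exact ENat.toENNReal_le.1 (by exact_mod_cast this)
    have h2 : G.dist x z ≤ (n * n ^ p : ℕ) := by
      refine (WGraph.capped_dist hG x z).resolve_left fun h3 => ?_
      rw [h3] at h1
      simp at h1
    rw [← pow_succ'] at h2
    rcases min_choice (δ x z).toNat (n ^ (p + 1)) with h3 | h3 <;> rw [h3]
    exacts [h1, h2]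
  · intro x z hz q
    rw [hval x z hz]
    refine le_trans ?_ (toReal_bound ha0 (h.upper x z hz) (WGraph.dist_le_walkWeight q))
    exact_mod_cast min_le_left _ _
  · intro x z hz t ht q
    rw [hval x z hz]
    refine le_trans ?_ (toReal_bound ha0 (h.far x z hz t ht) (WGraph.dist_le_walkWeight q))
    exact_mod_cast min_le_left _ _

theorem hub_mem_near {n : ℕ} (M : ℕ) {I : Fin n → LocalInput n} {S : Finset (Fin n)}
    (hS : ∀ x, ((I x).near ∩ S).Nonempty) (x : Fin n) : hub M (I x) S x ∈ (I x).near :=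
  (Finset.mem_inter.1 (hub_spec M (I x) x (hS x)).1).1

theorem hub_mem {n : ℕ} (M : ℕ) {I : Fin n → LocalInput n} {S : Finset (Fin n)}
    (hS : ∀ x, ((I x).near ∩ S).Nonempty) (x : Fin n) : hub M (I x) S x ∈ S :=
  (Finset.mem_inter.1 (hub_spec M (I x) x (hS x)).1).2

namespace Near

variable {n M : ℕ} {G : WGraph (Fin n)} {a : ℝ} {I : Fin n → LocalInput n} (h : Near G a M I)
  {S : Finset (Fin n)} (hS : ∀ x, ((I x).near ∩ S).Nonempty)

include h

theorem edges_le (x u : Fin n) (w : ℕ) (hw : (I x).edges u = some w) : w ≤ M := by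
  rw [h.edges, WGraph.incident] at hw
  split_ifs at hw with h1
  cases hw
  exact h.weights _ h1

theorem dist_le_hop (x u : Fin n) : G.dist x u ≤ hop (I x) x u := by
  unfold hop
  split_ifs with h1
  · rw [h1, G.dist_self]
  · rw [h.edges, WGraph.incident]
    split_ifs with h2
    · exact WGraph.dist_le_weight h2
    · exact le_top

theorem hop_of_adj {x u : Fin n} (hx : G.graph.Adj x u) : hop (I x) x u = G.weight s(x, u) := by
  rw [hop, if_neg hx.ne', h.edges, WGraph.incident, if_pos hx]
  rfl

theorem capped_cost (S : Finset (Fin n)) (s s' : Fin n) : Capped (4 * M) (cost M I S s s') := by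
  have hrad (y : Fin n) : Capped M (rad M (I y) S y) := .coe (rad_le M (I y) S y)
  refine .iInf fun x => .iInf fun _ => .iInf fun z => .iInf fun _ => ?_
  exact Capped.mono ((hrad x).add (Capped.add (.coe (val_le M (I x) z))
    (capped_reach M hrad (h.edges_le z) s'))) (by omega)

include hS

theorem dist_hub_le (x : Fin n) : G.dist x (hub M (I x) S x) ≤ rad M (I x) S x :=
  h.lower x _ (hub_mem_near M hS x)

/-- Each term of the infimum dominates the length of a real route from `s` through `x`, `z` and `y`
to `s'`. -/
theorem dist_le_cost (s s' : Fin n) : G.dist s s' ≤ cost M I S s s' := by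
  refine le_iInf fun x => le_iInf fun hx => le_iInf fun z => le_iInf fun hz => ?_
  have h1 : G.dist s x ≤ rad M (I x) S x := by
    rw [G.dist_comm, ← hx]
    exact h.dist_hub_le hS x
  have h2 : G.dist x z ≤ val M (I x) z := h.lower x z (ball_subset M (I x) S x hz)
  have h3 : G.dist z s' ≤
      reach (fun y => hub M (I y) S y) (fun y => rad M (I y) S y) (I z) z s' := by
    refine le_iInf fun y => le_iInf fun hy => ?_
    refine (G.dist_triangle z y s').trans (add_le_add (h.dist_le_hop z y) ?_)
    rw [← hy]
    exact h.dist_hub_le hS y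
  exact (G.dist_triangle s x s').trans
    (add_le_add h1 ((G.dist_triangle x z s').trans (add_le_add h2 h3)))

/-- The estimate of `x` to itself is zero. If `x` came after its hub, the radius would be zero too,
making the hub equal to `x`. -/
theorem mem_ball_self (x : Fin n) : x ∈ ball M (I x) S x := by
  by_contra hx
  have h1 := rad_le_of_notMem_ball M (I x) S x (h.self_mem x) hx
  have h2 := h.upper x x (h.self_mem x) .nil
  have h3 : val M (I x) x = 0 := by
    have h2 : (val M (I x) x : ℝ) ≤ 0 := by simpa [WGraph.walkWeight] using h2
    exact_mod_cast le_antisymm h2 (by positivity)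
  have h4 := h.dist_hub_le hS x
  rw [h3, Nat.le_zero] at h1
  rw [h1] at h4
  have h5 := WGraph.eq_of_dist_eq_zero (le_antisymm h4 zero_le)
  exact hx (Finset.mem_filter.2 ⟨h.self_mem x, by rw [← h5]⟩)

/-- A node outside the ball either follows the hub in the near set, so its estimate dominates the
radius, or is outside the near set, where the `far` condition applies to the hub. -/
theorem rad_le_of_notMem {x y : Fin n} (hy : y ∉ ball M (I x) S x) (p : G.graph.Walk x y) :
    (rad M (I x) S x : ℝ) ≤ a * G.walkWeight p := by
  by_cases hy' : y ∈ (I x).near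
  · refine le_trans ?_ (h.upper x y hy' p)
    exact_mod_cast rad_le_of_notMem_ball M (I x) S x hy' hy
  · exact h.far x _ (hub_mem_near M hS x) y hy' p

theorem rad_le_of_mem {x s : Fin n} (hs : s ∈ S) (p : G.graph.Walk x s) :
    (rad M (I x) S x : ℝ) ≤ a * G.walkWeight p := by
  by_cases hs' : s ∈ (I x).near
  · refine le_trans ?_ (h.upper x s hs' p)
    exact_mod_cast val_le_of_key_le M (I x)
      ((hub_spec M (I x) x (hS x)).2 s (Finset.mem_inter.2 ⟨hs', hs⟩))
  · exact h.far x _ (hub_mem_near M hS x) s hs' p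

/-- The skeleton graph over `S`. -/
noncomputable def skeleton : WGraph (Fin n) where
  graph :=
    { Adj := fun s t => s ≠ t ∧ s ∈ S ∧ t ∈ S ∧ min (cost M I S s t) (cost M I S t s) ≠ ⊤
      symm := ⟨fun s t hst => ⟨hst.1.symm, hst.2.2.1, hst.2.1, by rw [min_comm]; exact hst.2.2.2⟩⟩
      loopless := ⟨fun s hs => hs.1 rfl⟩ }
  weight := Sym2.lift ⟨fun s t => (min (cost M I S s t) (cost M I S t s)).toNat,
    fun s t => by simp only [min_comm]⟩
  weight_pos := by
    rintro ⟨s, t⟩ hst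
    have hst : s ≠ t ∧ s ∈ S ∧ t ∈ S ∧ min (cost M I S s t) (cost M I S t s) ≠ ⊤ := hst
    refine Nat.pos_of_ne_zero fun h0 => ?_
    have h0 : (min (cost M I S s t) (cost M I S t s)).toNat = 0 := h0
    have h1 : G.dist s t ≤ min (cost M I S s t) (cost M I S t s) :=
      le_min (h.dist_le_cost hS s t) (by rw [G.dist_comm]; exact h.dist_le_cost hS t s)
    rw [← ENat.natCast_toNat hst.2.2.2, h0] at h1
    exact hst.1 (WGraph.eq_of_dist_eq_zero (le_antisymm h1 zero_le))

theorem skeleton_isOver : (h.skeleton hS).IsOver S := fun _ _ huv => ⟨huv.2.1, huv.2.2.1⟩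

theorem localSkeleton_skeleton (v : Fin n) : localSkeleton S (h.skeleton hS) v =
    ⟨decide (v ∈ S), fun u => skeletonEdge S v u (min (cost M I S v u) (cost M I S u v))⟩ := by
  classical
  unfold localSkeleton
  congr 1
  funext u
  unfold WGraph.incident skeletonEdge
  exact if_congr Iff.rfl rfl rfl

theorem skeleton_weightsLE : (h.skeleton hS).WeightsLE (4 * M) := by
  rintro ⟨s, t⟩ hst
  have hst : s ≠ t ∧ s ∈ S ∧ t ∈ S ∧ min (cost M I S s t) (cost M I S t s) ≠ ⊤ := hst
  change (min (cost M I S s t) (cost M I S t s)).toNat ≤ 4 * M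
  apply ENat.toNat_le_of_le_natCast
  rcases le_total (cost M I S s t) (cost M I S t s) with h1 | h1
  · rw [min_eq_left h1] at hst ⊢
    exact (h.capped_cost S s t).resolve_left hst.2.2.2
  · rw [min_eq_right h1] at hst ⊢
    exact (h.capped_cost S t s).resolve_left hst.2.2.2

theorem skeleton_dist_le_cost {s t : Fin n} (hs : s ∈ S) (ht : t ∈ S) :
    (h.skeleton hS).dist s t ≤ cost M I S s t := by
  by_cases hst : s = t
  · rw [hst, WGraph.dist_self]
    exact zero_le
  by_cases hc : cost M I S s t = ⊤
  · rw [hc]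
    exact le_top
  have hm : min (cost M I S s t) (cost M I S t s) ≠ ⊤ :=
    ((min_le_left _ _).trans_lt (lt_top_iff_ne_top.2 hc)).ne
  have hadj : (h.skeleton hS).graph.Adj s t := ⟨hst, hs, ht, hm⟩
  refine (WGraph.dist_le_weight hadj).trans ?_
  change ((min (cost M I S s t) (cost M I S t s)).toNat : ℕ∞) ≤ _
  rw [ENat.natCast_toNat hm]
  exact min_le_left _ _

theorem dist_le_skeleton_dist (s t : Fin n) : G.dist s t ≤ (h.skeleton hS).dist s t := by
  refine le_iInf fun p => ?_
  change G.dist s t ≤ ((h.skeleton hS).walkWeight p : ℕ∞)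
  induction p with
  | nil => rw [G.dist_self]; exact zero_le
  | @cons u v w e p ih =>
    rw [WGraph.walkWeight_cons, Nat.cast_add]
    refine (G.dist_triangle u v w).trans (add_le_add ?_ ih)
    change G.dist u v ≤ ((min (cost M I S u v) (cost M I S v u)).toNat : ℕ∞)
    rw [ENat.natCast_toNat e.2.2.2]
    exact le_min (h.dist_le_cost hS u v) (by rw [G.dist_comm]; exact h.dist_le_cost hS v u)

theorem cost_le {x z y : Fin n} (hz : z ∈ ball M (I x) S x) :
    (h.skeleton hS).dist (hub M (I x) S x) (hub M (I y) S y) ≤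
      (rad M (I x) S x : ℕ∞) + (val M (I x) z + (hop (I z) z y + rad M (I y) S y)) := by
  refine (h.skeleton_dist_le_cost hS (hub_mem M hS x) (hub_mem M hS y)).trans ?_
  unfold cost
  refine iInf_le_of_le x (iInf_le_of_le rfl (iInf_le_of_le z (iInf_le_of_le hz ?_)))
  exact add_le_add le_rfl (add_le_add le_rfl (iInf_le_of_le y (iInf_le_of_le rfl le_rfl)))

/-- Along a walk, the distance between hubs in the skeleton graph. -/
theorem exists_skeleton_bound (ha : 1 ≤ a) {x v : Fin n} (p : G.graph.Walk x v) :
    ∃ W : ℕ, (h.skeleton hS).dist (hub M (I x) S x) (hub M (I v) S v) ≤ W ∧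
      (rad M (I x) S x : ℝ) + W ≤
        3 * a * G.walkWeight p + (2 * a + 1) * rad M (I v) S v := by
  induction hl : p.length using Nat.strong_induction_on generalizing x with
  | _ m ih =>
    by_cases hv : v ∈ ball M (I x) S x
    -- The connection with `z = y = v` and a trivial step. Continuing the walk to the hub of `v`
    -- gives `rad x ≤ a * (|p| + rad v)`, which produces the term `(2 * a + 1) * rad v`.
    · refine ⟨rad M (I x) S x + (val M (I x) v + (0 + rad M (I v) S v)), ?_, ?_⟩
      · have := h.cost_le hS (y := v) hv
        rw [hop, if_pos rfl] at this
        exact_mod_cast this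
      · obtain ⟨q, hq⟩ := WGraph.dist_le_natCast (h.dist_hub_le hS v)
        have h1 := h.rad_le_of_mem hS (hub_mem M hS v) (p.append q)
        have h2 := h.upper x v (ball_subset M (I x) S x hv) p
        have h3 : (G.walkWeight q : ℝ) ≤ rad M (I v) S v := by exact_mod_cast hq
        rw [WGraph.walkWeight_append] at h1
        push_cast at h1 ⊢
        nlinarith
    · obtain ⟨z, y, hzy, p₁, p₂, hz, hy, hsum, hlen⟩ :=
        WGraph.exists_crossing p (h.mem_ball_self hS x) hv
      obtain ⟨W, hW, hW'⟩ := ih p₂.length (by omega) p₂ rfl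
      -- The invariant carries `rad x` on the left so that `rad y` is absorbed by the induction
      -- hypothesis. What remains is twice `rad x`, the estimate to `z` and the crossing edge: at
      -- most `3 * a` times the segment.
      refine ⟨rad M (I x) S x + (val M (I x) z + (G.weight s(z, y) + rad M (I y) S y)) + W, ?_, ?_⟩
      · have := h.cost_le hS (y := y) hz
        rw [h.hop_of_adj hzy] at this
        refine (WGraph.dist_triangle _ (hub M (I y) S y) _).trans ?_
        push_cast
        exact add_le_add this hW
      · have h1 := h.rad_le_of_notMem hS hy (p₁.append hzy.toWalk)
        have h2 := h.upper x z (ball_subset M (I x) S x hz) p₁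
        have h3 : G.walkWeight hzy.toWalk = G.weight s(z, y) := by
          simp [SimpleGraph.Adj.toWalk, WGraph.walkWeight]
        rw [WGraph.walkWeight_append, h3] at h1
        rw [← hsum]
        push_cast at h1 ⊢
        have h4 : (0 : ℝ) ≤ G.weight s(z, y) := by positivity
        nlinarith

/-- The path through the skeleton graph approximates distances to nodes outside near sets. -/
theorem skeleton_approx (ha : 1 ≤ a) {l : ℝ} (hl : 1 ≤ l) {u v : Fin n} (hu : u ∉ (I v).near) :
    ((rad M (I u) S u : ℕ) : ℝ≥0∞) + ENNReal.ofReal l *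
      ((h.skeleton hS).dist (hub M (I u) S u) (hub M (I v) S v) : ℝ≥0∞) +
      ((rad M (I v) S v : ℕ) : ℝ≥0∞) ≤
    ENNReal.ofReal (7 * l * a ^ 2) * (G.dist u v : ℝ≥0∞) := by
  have hpos : 0 < 7 * l * a ^ 2 := by positivity
  by_cases hd : G.dist u v = ⊤
  · rw [hd, ENat.toENNReal_top, ENNReal.mul_top (by simpa using hpos)]
    exact le_top
  obtain ⟨p, hp⟩ := WGraph.exists_walk_of_dist_ne_top hd
  obtain ⟨W, hW, hW'⟩ := h.exists_skeleton_bound hS ha p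
  have h1 := h.far v _ (hub_mem_near M hS v) u hu p.reverse
  rw [WGraph.walkWeight_reverse] at h1
  change (rad M (I v) S v : ℝ) ≤ _ at h1
  have h2 : ((h.skeleton hS).dist (hub M (I u) S u) (hub M (I v) S v) : ℝ≥0∞) ≤ (W : ℝ≥0∞) := by
    exact_mod_cast ENat.toENNReal_le.2 hW
  have h3 : (rad M (I u) S u : ℝ) + l * W + rad M (I v) S v ≤
      7 * l * a ^ 2 * G.walkWeight p := by
    set r := (rad M (I v) S v : ℝ)
    set q := (rad M (I u) S u : ℝ)
    set w := (G.walkWeight p : ℝ)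
    have hq : 0 ≤ q := by positivity
    have hr : 0 ≤ r := by positivity
    have hw : 0 ≤ w := by positivity
    have e1 : q + l * W + r ≤ l * (q + W + r) := by nlinarith
    have e2 : q + W + r ≤ 3 * a * w + (2 * a + 2) * (a * w) := by nlinarith
    have e3 : 3 * a * w + (2 * a + 2) * (a * w) ≤ 7 * a ^ 2 * w := by
      have : a ≤ a ^ 2 := by nlinarith
      nlinarith
    calc q + l * W + r ≤ l * (7 * a ^ 2 * w) :=
          e1.trans (mul_le_mul_of_nonneg_left (e2.trans e3) (by linarith))
      _ = 7 * l * a ^ 2 * w := by ring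
  calc _ ≤ ((rad M (I u) S u : ℕ) : ℝ≥0∞) + ENNReal.ofReal l * (W : ℝ≥0∞) +
        ((rad M (I v) S v : ℕ) : ℝ≥0∞) := by gcongr
    _ = ENNReal.ofReal ((rad M (I u) S u : ℝ) + l * W + rad M (I v) S v) := by
      rw [ENNReal.ofReal_add (by positivity) (by positivity),
        ENNReal.ofReal_add (by positivity) (by positivity), ENNReal.ofReal_mul (by positivity)]
      simp only [ENNReal.ofReal_natCast]
    _ ≤ ENNReal.ofReal (7 * l * a ^ 2 * G.walkWeight p) := ENNReal.ofReal_le_ofReal h3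
    _ = _ := by
      rw [ENNReal.ofReal_mul hpos.le, ENNReal.ofReal_natCast, hp, ENat.toENNReal_coe]

end Near

/-! ### Extension of skeleton estimates to all nodes -/

/-- Round an estimate down to a natural number that is at most `K`, or to infinity. -/
noncomputable def roundDown (K : ℕ) (x : ℝ≥0∞) : ℕ∞ :=
  if x = ⊤ then ⊤ else ((min ⌊x.toReal⌋₊ K : ℕ) : ℕ∞)

theorem capped_roundDown (K : ℕ) (x : ℝ≥0∞) : Capped K (roundDown K x) := by
  unfold roundDown
  split_ifs
  · exact Or.inl rfl
  · exact .coe (min_le_right _ _)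

theorem roundDown_le (K : ℕ) (x : ℝ≥0∞) : (roundDown K x : ℝ≥0∞) ≤ x := by
  unfold roundDown
  split_ifs with h
  · rw [h]
    exact le_top
  · rw [ENat.toENNReal_coe]
    calc ((min ⌊x.toReal⌋₊ K : ℕ) : ℝ≥0∞) ≤ (⌊x.toReal⌋₊ : ℝ≥0∞) := by
          exact_mod_cast min_le_left _ _
      _ = ENNReal.ofReal (⌊x.toReal⌋₊ : ℝ) := (ENNReal.ofReal_natCast _).symm
      _ ≤ ENNReal.ofReal x.toReal :=
          ENNReal.ofReal_le_ofReal (Nat.floor_le ENNReal.toReal_nonneg)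
      _ = x := ENNReal.ofReal_toReal h

/-- Estimates are arbitrary extended reals and must be shortened to fit a message. Rounding down is
harmless because the distance below is an integer at most `K` or infinite. -/
theorem le_roundDown {K : ℕ} {d : ℕ∞} {x : ℝ≥0∞} (hd : Capped K d) (h : (d : ℝ≥0∞) ≤ x) :
    d ≤ roundDown K x := by
  unfold roundDown
  split_ifs with hx
  · exact le_top
  · have hd' : d ≠ ⊤ := by
      rintro rfl
      exact hx (top_le_iff.1 (by simpa using h))
    obtain ⟨m, rfl⟩ := ENat.ne_top_iff_exists.1 hd'
    have h1 : m ≤ K := by exact_mod_cast hd.resolve_left hd'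
    have h2 : (m : ℝ) ≤ x.toReal := by
      rw [ENat.toENNReal_coe] at h
      simpa using ENNReal.toReal_mono hx h
    exact_mod_cast le_min (Nat.le_floor h2) h1

section Extend

variable {n : ℕ} (M K : ℕ)

open Classical in
/-- The extension of distance estimates from the skeleton graph, as a program for node `v`. -/
noncomputable def extend [Nonempty (Fin n)] (β : ℕ) (v : Fin n) (I : LocalInput n) (isNode : Bool)
    (row : Fin n → Option ℝ≥0∞) : Prog n β (Fin n → ℝ≥0∞) :=
  .exchange (T := Bool) (fun _ => isNode) fun b =>
  .exchange (T := Fin n × Val K × Val K)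
    (fun u => (hub M I (Finset.univ.filter fun s => b s = true) v,
      toVal K (rad M I (Finset.univ.filter fun s => b s = true) v),
      toVal K (if u ∈ I.near then (val M I u : ℕ∞) else ⊤))) fun info =>
  .exchange (T := Val K)
    (fun u => toVal K ((row (info u).1).elim ⊤ (roundDown K))) fun est =>
  .ret fun u => min (ofVal (info u).2.2 : ℝ≥0∞)
    (((ofVal (info v).2.1 + ofVal (est (info u).1) + ofVal (info u).2.1 : ℕ∞)) : ℝ≥0∞)

-- In the last round each hub sends every node `v` its own row entry at the hub of `v`. Thus `v`
-- learns the estimate from the hub of every `u`.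
open Classical in
theorem next_extend [Nonempty (Fin n)] {β : ℕ} {I : Fin n → LocalInput n} {S : Finset (Fin n)}
    (row : Fin n → Fin n → Option ℝ≥0∞) (h1 : Fits n β Bool)
    (h2 : Fits n β (Fin n × Val K × Val K)) (h3 : Fits n β (Val K)) (hM : M ≤ K) :
    Prog.next^[3] (fun v => extend M K β v (I v) (decide (v ∈ S)) (row v)) = fun v => .ret fun u =>
      min (((if v ∈ (I u).near then (val M (I u) v : ℕ∞) else ⊤ : ℕ∞)) : ℝ≥0∞)
        (((rad M (I v) S v : ℕ∞) +
          (row (hub M (I u) S u) (hub M (I v) S v)).elim ⊤ (roundDown K) +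
          (rad M (I u) S u : ℕ∞) : ℕ∞) : ℝ≥0∞) := by
  have hS : (Finset.univ.filter fun s => decide (s ∈ S) = true) = S := by
    ext s
    simp
  have hrad (y : Fin n) : ofVal (toVal K (rad M (I y) S y)) = rad M (I y) S y :=
    ofVal_toVal (.coe ((rad_le M (I y) S y).trans hM))
  have hval (u v : Fin n) : ofVal (toVal K (if v ∈ (I u).near then (val M (I u) v : ℕ∞) else ⊤)) =
      if v ∈ (I u).near then (val M (I u) v : ℕ∞) else ⊤ := by
    apply ofVal_toVal
    split_ifs
    · exact .coe ((val_le M (I u) v).trans hM)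
    · exact Or.inl rfl
  have hrow (t s : Fin n) : ofVal (toVal K ((row t s).elim ⊤ (roundDown K))) =
      (row t s).elim ⊤ (roundDown K) := by
    apply ofVal_toVal
    rcases row t s with _ | x
    · exact Or.inl rfl
    · exact capped_roundDown K x
  unfold extend
  rw [Function.iterate_succ_apply, Prog.next_exchange h1, Function.iterate_succ_apply,
    Prog.next_exchange h2, Function.iterate_succ_apply, Prog.next_exchange h3,
    Function.iterate_zero_apply]
  simp only [hS, hrad, hval, hrow]

open Classical in
theorem extend_approx {M K : ℕ} {G : WGraph (Fin n)} {a : ℝ} {I : Fin n → LocalInput n}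
    (h : Near G a M I) {S : Finset (Fin n)} (hS : ∀ x, ((I x).near ∩ S).Nonempty) (ha : 1 ≤ a)
    {l : ℝ} (hl : 1 ≤ l) (hK : n * (4 * M) ≤ K) {D : Fin n → Fin n → ℝ≥0∞}
    (hD : IsApproxOn S l (h.skeleton hS).dist D) :
    IsApproxOn Finset.univ (7 * l * a ^ 2) G.dist fun v u =>
      min (((if v ∈ (I u).near then (val M (I u) v : ℕ∞) else ⊤ : ℕ∞)) : ℝ≥0∞)
        (((rad M (I v) S v : ℕ∞) +
          (distRow S D (hub M (I u) S u) (hub M (I v) S v)).elim ⊤ (roundDown K) +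
          (rad M (I u) S u : ℕ∞) : ℕ∞) : ℝ≥0∞) := by
  intro v _ u _
  have hu := hub_mem M hS u
  have hv := hub_mem M hS v
  have hrow : distRow S D (hub M (I u) S u) (hub M (I v) S v) =
      some (D (hub M (I u) S u) (hub M (I v) S v)) := if_pos ⟨hu, hv⟩
  simp only [hrow, Option.elim_some]
  obtain ⟨hD1, hD2⟩ := hD _ hu _ hv
  constructor
  · refine le_min ?_ ?_
    · refine ENat.toENNReal_le.2 ?_
      split_ifs with huv
      · rw [G.dist_comm]
        exact h.lower u v huv
      · exact le_top
    · refine ENat.toENNReal_le.2 ?_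
      have h1 : (h.skeleton hS).dist (hub M (I u) S u) (hub M (I v) S v) ≤
          roundDown K (D (hub M (I u) S u) (hub M (I v) S v)) :=
        le_roundDown ((WGraph.capped_dist (h.skeleton_weightsLE hS) _ _).mono hK) hD1
      refine (G.dist_triangle v (hub M (I u) S u) u).trans (add_le_add ?_ ?_)
      · refine (G.dist_triangle v (hub M (I v) S v) _).trans
          (add_le_add (h.dist_hub_le hS v) ?_)
        rw [G.dist_comm]
        exact (h.dist_le_skeleton_dist hS _ _).trans h1
      · rw [G.dist_comm]
        exact h.dist_hub_le hS u
  · by_cases huv : v ∈ (I u).near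
    · refine (min_le_left _ _).trans ?_
      rw [if_pos huv, ENat.toENNReal_coe, G.dist_comm]
      have hpos : 0 < 7 * l * a ^ 2 := by positivity
      by_cases hd : G.dist u v = ⊤
      · rw [hd, ENat.toENNReal_top, ENNReal.mul_top (by simpa using hpos)]
        exact le_top
      obtain ⟨p, hp⟩ := WGraph.exists_walk_of_dist_ne_top hd
      rw [hp, ENat.toENNReal_coe, ← ENNReal.ofReal_natCast (G.walkWeight p),
        ← ENNReal.ofReal_mul hpos.le, ← ENNReal.ofReal_natCast]
      refine ENNReal.ofReal_le_ofReal ((h.upper u v huv p).trans ?_)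
      refine mul_le_mul_of_nonneg_right ?_ (by positivity)
      have h2 : a ≤ a ^ 2 := by nlinarith
      nlinarith
    · refine (min_le_right _ _).trans (le_trans ?_ (h.skeleton_approx hS ha hl huv))
      rw [ENat.toENNReal_add, ENat.toENNReal_add, ENat.toENNReal_coe, ENat.toENNReal_coe]
      gcongr
      refine (roundDown_le K _).trans ?_
      rwa [(h.skeleton hS).dist_comm (hub M (I v) S v)]

end Extend

/-! ### Success probability of the sampling -/

section Probability

open Classical in
/-- The nodes all of whose bits are set. -/
noncomputable def sampled {n j : ℕ} (ξ : Fin n → Fin j → Bool) : Finset (Fin n) :=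
  Finset.univ.filter fun v => ∀ i, ξ v i = true

open Classical in
/-- The number of outcomes in which no node of `A` is sampled. -/
theorem card_disjoint_sampled {n j : ℕ} (A : Finset (Fin n)) :
    ((Finset.univ.filter fun ξ : Fin n → Fin j → Bool => Disjoint A (sampled ξ)).card : ℝ) =
      Fintype.card (Fin n → Fin j → Bool) * (1 - 1 / 2 ^ j) ^ A.card := by
  -- Independence: the event is a product set in which each node of `A` avoids exactly the all-true
  -- bit string.
  have h1 : (Finset.univ.filter fun ξ : Fin n → Fin j → Bool => Disjoint A (sampled ξ)) =
      Fintype.piFinset fun v =>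
        if v ∈ A then Finset.univ.erase (fun _ => true) else Finset.univ := by
    ext ξ
    simp only [Finset.mem_filter, Finset.mem_univ, true_and, Fintype.mem_piFinset,
      Finset.disjoint_left, sampled]
    refine forall_congr' fun v => ?_
    by_cases hv : v ∈ A
    · simp [hv, funext_iff]
    · simp [hv]
  have h2 : (Finset.univ : Finset (Fin n)).card = A.card + (n - A.card) := by
    have := Finset.card_le_univ A
    simp only [Finset.card_univ, Fintype.card_fin] at this ⊢
    omega
  have h3 : (2 : ℝ) ^ j ≠ 0 := by positivity
  rw [h1, Fintype.card_piFinset]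
  simp only [apply_ite Finset.card, Finset.card_erase_of_mem (Finset.mem_univ _),
    Finset.card_univ, Fintype.card_fun, Fintype.card_bool, Fintype.card_fin]
  rw [Finset.prod_ite, Finset.prod_const, Finset.prod_const]
  have h4 : (Finset.univ.filter fun v => v ∈ A).card = A.card := by simp
  have h5 : (Finset.univ.filter fun v => v ∉ A).card = n - A.card := by
    rw [Finset.filter_not, Finset.card_sdiff_of_subset (Finset.filter_subset _ _), h4]
    simp
  have h6 : (2 ^ j) ^ n = (2 ^ j : ℝ) ^ A.card * (2 ^ j) ^ (n - A.card) := by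
    rw [← pow_add, ← h2]
    simp
  rw [h4, h5]
  push_cast [Nat.cast_sub (Nat.one_le_two_pow (n := j))]
  rw [h6]
  have h7 : (1 - 1 / 2 ^ j : ℝ) = (2 ^ j - 1) / 2 ^ j := by field_simp
  rw [h7, div_pow]
  field_simp

open Classical in
/-- Markov's inequality for counting. -/
theorem card_filter_lt_le {Ω : Type} [Fintype Ω] (f : Ω → ℕ) {m : ℝ} (hm : 0 < m)
    (h : (∑ ξ, (f ξ : ℝ)) ≤ Fintype.card Ω * m) :
    4 * ((Finset.univ.filter fun ξ => 4 * m < f ξ).card : ℝ) ≤ Fintype.card Ω := by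
  have h1 : ((Finset.univ.filter fun ξ => 4 * m < f ξ).card : ℝ) * (4 * m) ≤ ∑ ξ, (f ξ : ℝ) := by
    rw [← nsmul_eq_mul]
    refine (Finset.card_nsmul_le_sum _ (fun ξ => (f ξ : ℝ)) _ fun ξ hξ =>
      (Finset.mem_filter.1 hξ).2.le).trans ?_
    exact Finset.sum_le_sum_of_subset_of_nonneg (Finset.filter_subset _ _)
      fun _ _ _ => by positivity
  nlinarith

theorem card_eq_sum_ite {n : ℕ} (A : Finset (Fin n)) (P : Fin n → Prop) [DecidablePred P] :
    ((A.filter P).card : ℝ) = ∑ v ∈ A, if P v then 1 else 0 := by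
  simp

/-- Linearity of expectation: a node is sampled with probability `1 / 2 ^ j`, and its near set is
missed with probability `(1 - 1 / 2 ^ j) ^ k`. -/
theorem sum_card_cover_le {n j k : ℕ} {N : Fin n → Finset (Fin n)} (hN : ∀ u, (N u).card = k) :
    ∑ ξ : Fin n → Fin j → Bool, ((cover N (sampled ξ)).card : ℝ) ≤
      Fintype.card (Fin n → Fin j → Bool) * (n * (1 / 2 ^ j + (1 - 1 / 2 ^ j) ^ k)) := by
  classical
  have h1 (ξ : Fin n → Fin j → Bool) : ((cover N (sampled ξ)).card : ℝ) ≤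
      ∑ u, (1 - (if Disjoint {u} (sampled ξ) then 1 else 0) +
        if Disjoint (N u) (sampled ξ) then 1 else 0) := by
    rw [cover, card_eq_sum_ite]
    refine Finset.sum_le_sum fun u _ => ?_
    simp only [Finset.disjoint_singleton_left]
    by_cases h : u ∈ sampled ξ <;> by_cases h' : Disjoint (N u) (sampled ξ) <;> simp [h, h']
  refine (Finset.sum_le_sum fun ξ _ => h1 ξ).trans ?_
  rw [Finset.sum_comm]
  have h2 (A : Finset (Fin n)) : ∑ ξ : Fin n → Fin j → Bool,
      (if Disjoint A (sampled ξ) then (1 : ℝ) else 0) =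
        Fintype.card (Fin n → Fin j → Bool) * (1 - 1 / 2 ^ j) ^ A.card := by
    rw [← card_disjoint_sampled]
    simp
  simp only [Finset.sum_add_distrib, Finset.sum_sub_distrib, h2, hN, Finset.card_singleton,
    Finset.sum_const, Finset.card_univ, nsmul_eq_mul, mul_one, Fintype.card_fin, pow_one]
  apply le_of_eq
  ring

/-- The nodes up to the first node of `U` form the ball of any larger set of hubs. -/
theorem mem_ball_of_subset {n M : ℕ} {I : LocalInput n} {S U : Finset (Fin n)} {v z : Fin n}
    (hS : (I.near ∩ S).Nonempty) (hU : U ⊆ S) (hz : z ∈ ball M I S v) :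
    Disjoint (I.near.filter fun y => key M I y < key M I z) U := by
  rw [Finset.disjoint_left]
  intro y hy hyU
  obtain ⟨hy1, hy2⟩ := Finset.mem_filter.1 hy
  have h1 := (hub_spec M I v hS).2 y (Finset.mem_inter.2 ⟨hy1, hU hyU⟩)
  have h2 := (Finset.mem_filter.1 hz).2
  omega

/-- By injectivity of `f`, the ranks of the elements of `A` are exactly `0, ..., A.card - 1`. -/
theorem sum_pow_rank {α : Type} [DecidableEq α] (A : Finset α) (f : α → ℕ)
    (hf : Function.Injective f) (x : ℝ) :
    ∑ z ∈ A, x ^ (A.filter fun y => f y < f z).card = ∑ i ∈ Finset.range A.card, x ^ i := by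
  induction A using Finset.induction_on_max_value f with
  | empty => simp
  | insert a A ha hmax ih =>
    have hlt : ∀ z ∈ A, f z < f a := fun z hz =>
      lt_of_le_of_ne (hmax z hz) fun h => ha (hf h ▸ hz)
    rw [Finset.sum_insert ha, Finset.card_insert_of_notMem ha, Finset.sum_range_succ, ← ih,
      add_comm]
    congr 1
    · refine Finset.sum_congr rfl fun z hz => ?_
      rw [Finset.filter_insert, if_neg (by have := hlt z hz; omega)]
    · rw [Finset.filter_insert, if_neg (lt_irrefl _), Finset.filter_true_of_mem hlt]

/-- A node of rank `i` in a near set can lie in the ball only if the `i` nodes before it are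
unsampled. Summing `(1 - 1 / 2 ^ j) ^ i` over the ranks gives at most `2 ^ j`. -/
theorem sum_totalBall_le {n j : ℕ} (M : ℕ) {I : Fin n → LocalInput n}
    (hI : ∀ x, x ∈ (I x).near) :
    ∑ ξ : Fin n → Fin j → Bool,
        (totalBall M I (cover (fun u => (I u).near) (sampled ξ)) : ℝ) ≤
      Fintype.card (Fin n → Fin j → Bool) * (n * 2 ^ j) := by
  classical
  have h1 (ξ : Fin n → Fin j → Bool) :
      (totalBall M I (cover (fun u => (I u).near) (sampled ξ)) : ℝ) ≤
      ∑ x, ∑ z ∈ (I x).near, if Disjoint ((I x).near.filter fun y => key M (I x) y < key M (I x) z)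
        (sampled ξ) then 1 else 0 := by
    rw [totalBall, Nat.cast_sum]
    refine Finset.sum_le_sum fun x _ => ?_
    rw [← card_eq_sum_ite, Nat.cast_le]
    refine Finset.card_le_card fun z hz => Finset.mem_filter.2 ⟨ball_subset _ _ _ _ hz, ?_⟩
    refine mem_ball_of_subset (cover_hits (N := fun u => (I u).near) (hI x)) ?_ hz
    intro u hu
    simp [cover, hu]
  have h2 (A : Finset (Fin n)) : ∑ ξ : Fin n → Fin j → Bool,
      (if Disjoint A (sampled ξ) then (1 : ℝ) else 0) =
        Fintype.card (Fin n → Fin j → Bool) * (1 - 1 / 2 ^ j) ^ A.card := by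
    rw [← card_disjoint_sampled]
    simp
  have h3 (m : ℕ) : ∑ i ∈ Finset.range m, (1 - 1 / 2 ^ j : ℝ) ^ i ≤ 2 ^ j := by
    have h4 : (0 : ℝ) < 1 / 2 ^ j := by positivity
    have h5 : (1 : ℝ) / 2 ^ j ≤ 1 := by
      rw [div_le_one (by positivity)]
      exact one_le_pow₀ (by norm_num)
    have h6 := mul_neg_geom_sum (1 - 1 / 2 ^ j : ℝ) m
    have h7 : (0 : ℝ) ≤ (1 - 1 / 2 ^ j) ^ m := pow_nonneg (by linarith) m
    rw [sub_sub_cancel] at h6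
    have h8 : ∑ i ∈ Finset.range m, (1 - 1 / 2 ^ j : ℝ) ^ i =
        2 ^ j * (1 - (1 - 1 / 2 ^ j) ^ m) := by
      rw [← h6]
      field_simp
    rw [h8]
    have h9 : (0 : ℝ) < 2 ^ j := by positivity
    nlinarith
  refine (Finset.sum_le_sum fun ξ _ => h1 ξ).trans ?_
  rw [Finset.sum_comm]
  have h4 (x : Fin n) : ∑ ξ : Fin n → Fin j → Bool, ∑ z ∈ (I x).near,
      (if Disjoint ((I x).near.filter fun y => key M (I x) y < key M (I x) z)
        (sampled ξ) then (1 : ℝ) else 0) ≤ Fintype.card (Fin n → Fin j → Bool) * 2 ^ j := by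
    rw [Finset.sum_comm]
    simp only [h2]
    rw [← Finset.mul_sum, sum_pow_rank _ _ (key_injective M (I x))]
    exact mul_le_mul_of_nonneg_left (h3 _) (by positivity)
  refine (Finset.sum_le_sum fun x _ => h4 x).trans ?_
  rw [Finset.sum_const, Finset.card_univ, Fintype.card_fin, nsmul_eq_mul]
  apply le_of_eq
  ring

/-- The requirements on a set of hubs `S` with balls of total size `t`. -/
def IsGood (n k : ℕ) (S : Finset (Fin n)) (t : ℕ) : Prop :=
  (S.card : ℝ) ≤ 16 * (n * Real.log (k + 1) / k) ∧ (t : ℝ) ≤ 4 * (n * (k / Real.log (k + 1)))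

/-- The number of random bits that decide whether a node is sampled. -/
theorem exists_bits (k : ℕ) (hk : 1 ≤ k) : ∃ j : ℕ, (2 : ℝ) ^ j ≤ k / Real.log (k + 1) ∧
    (1 : ℝ) / 2 ^ j + (1 - 1 / 2 ^ j) ^ k ≤ 4 * (Real.log (k + 1) / k) := by
  have hk' : (0 : ℝ) < k := by exact_mod_cast hk
  have hL : 0 < Real.log (k + 1) := Real.log_pos (by linarith)
  have hLk : Real.log (k + 1) ≤ k := by
    have := Real.log_le_sub_one_of_pos (x := (k : ℝ) + 1) (by linarith)
    linarith
  -- The largest power of two not exceeding `k / log (k + 1)`; the rounding costs a factor 2.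
  obtain ⟨j, hj1, hj2⟩ := exists_nat_pow_near (x := (k : ℝ) / Real.log (k + 1)) (y := 2)
    ((one_le_div hL).2 hLk) (by norm_num)
  refine ⟨j, hj1, ?_⟩
  have hp : (0 : ℝ) < 2 ^ j := by positivity
  have h1 : (1 : ℝ) / 2 ^ j ≤ 2 * (Real.log (k + 1) / k) := by
    rw [pow_succ, div_lt_iff₀ hL] at hj2
    rw [div_le_iff₀ hp]
    have : 2 * (Real.log (k + 1) / k) * 2 ^ j = (2 ^ j * 2 * Real.log (k + 1)) / k := by ring
    rw [this, le_div_iff₀ hk']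
    linarith
  have h2 : Real.log (k + 1) / k ≤ 1 / 2 ^ j := by
    rw [le_div_iff₀ hL] at hj1
    rw [div_le_div_iff₀ hk' hp]
    linarith
  have h3 : (1 - 1 / 2 ^ j : ℝ) ^ k ≤ 1 / (k + 1) := by
    have h4 : (1 - 1 / 2 ^ j : ℝ) ≤ Real.exp (-(Real.log (k + 1) / k)) :=
      (by linarith : (1 - 1 / 2 ^ j : ℝ) ≤ 1 - Real.log (k + 1) / k).trans
        (Real.one_sub_le_exp_neg _)
    have h5 : (0 : ℝ) ≤ 1 - 1 / 2 ^ j := by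
      rw [sub_nonneg, div_le_one hp]
      exact one_le_pow₀ (by norm_num)
    refine (pow_le_pow_left₀ h5 h4 k).trans_eq ?_
    rw [← Real.exp_nat_mul, mul_neg, mul_div_cancel₀ _ hk'.ne', Real.exp_neg,
      Real.exp_log (by linarith), one_div]
  -- From `1 - 1 / x ≤ log x` at `x = k + 1`.
  have h6 : (1 : ℝ) / (k + 1) ≤ Real.log (k + 1) / k := by
    have h7 := Real.one_sub_inv_le_log_of_pos (x := (k : ℝ) + 1) (by linarith)
    rw [div_le_div_iff₀ (by linarith) hk']
    have h8 : 1 - ((k : ℝ) + 1)⁻¹ = k / (k + 1) := by field_simp; ring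
    rw [h8, div_le_iff₀ (by linarith)] at h7
    linarith
  have : 0 < Real.log (k + 1) / k := by positivity
  linarith

open Classical in
/-- At most half of the outcomes of a trial are bad. -/
theorem card_bad_le {n j k : ℕ} (M : ℕ) (hn : 0 < n) (hk : 1 ≤ k)
    (hj : (2 : ℝ) ^ j ≤ k / Real.log (k + 1))
    (hj' : (1 : ℝ) / 2 ^ j + (1 - 1 / 2 ^ j) ^ k ≤ 4 * (Real.log (k + 1) / k))
    {I : Fin n → LocalInput n} (hI : ∀ x, x ∈ (I x).near) (hN : ∀ u, (I u).near.card = k) :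
    2 * ((Finset.univ.filter fun ξ : Fin n → Fin j → Bool =>
      ¬ IsGood n k (cover (fun u => (I u).near) (sampled ξ))
        (totalBall M I (cover (fun u => (I u).near) (sampled ξ)))).card : ℝ) ≤
      Fintype.card (Fin n → Fin j → Bool) := by
  have hk' : (0 : ℝ) < k := by exact_mod_cast hk
  have hn' : (0 : ℝ) < n := by exact_mod_cast hn
  have hL : 0 < Real.log (k + 1) := Real.log_pos (by linarith)
  -- Each requirement fails for at most a quarter of the outcomes. The factor 16 is Markov's 4 times
  -- the 4 in the expected number of hubs.
  have h1 := card_filter_lt_le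
    (fun ξ : Fin n → Fin j → Bool => (cover (fun u => (I u).near) (sampled ξ)).card)
    (m := 4 * (n * Real.log (k + 1) / k)) (by positivity) ((sum_card_cover_le hN).trans (by
      refine mul_le_mul_of_nonneg_left ?_ (by positivity)
      calc _ ≤ n * (4 * (Real.log (k + 1) / k)) := mul_le_mul_of_nonneg_left hj' hn'.le
        _ = _ := by ring))
  have h2 := card_filter_lt_le
    (fun ξ : Fin n → Fin j → Bool => totalBall M I (cover (fun u => (I u).near) (sampled ξ)))
    (m := n * (k / Real.log (k + 1))) (by positivity) ((sum_totalBall_le M hI).trans (by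
      refine mul_le_mul_of_nonneg_left ?_ (by positivity)
      exact mul_le_mul_of_nonneg_left hj hn'.le))
  have h3 : (Finset.univ.filter fun ξ : Fin n → Fin j → Bool =>
      ¬ IsGood n k (cover (fun u => (I u).near) (sampled ξ))
        (totalBall M I (cover (fun u => (I u).near) (sampled ξ)))) ⊆
      (Finset.univ.filter fun ξ : Fin n → Fin j → Bool => 4 * (4 * (n * Real.log (k + 1) / k)) <
        ((cover (fun u => (I u).near) (sampled ξ)).card : ℝ)) ∪
      (Finset.univ.filter fun ξ : Fin n → Fin j → Bool => 4 * (n * (k / Real.log (k + 1))) <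
        (totalBall M I (cover (fun u => (I u).near) (sampled ξ)) : ℝ)) := by
    intro ξ hξ
    simp only [Finset.mem_union, Finset.mem_filter, Finset.mem_univ, true_and]
    by_contra! h
    exact (Finset.mem_filter.1 hξ).2 ⟨h.1.trans_eq (by ring), h.2⟩
  have h4 : ((Finset.card _ : ℕ) : ℝ) ≤ _ :=
    Nat.cast_le.2 ((Finset.card_le_card h3).trans (Finset.card_union_le _ _))
  push_cast at h4
  linarith

/-- The bits of a trial, as part of all random bits. -/
noncomputable def trialBits {n r : ℕ} {T : Type} {j : ℕ} (e : T × Fin j ≃ Fin r) :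
    (Fin n → Fin r → Bool) ≃ (T → Fin n → Fin j → Bool) where
  toFun ω τ v i := ω v (e (τ, i))
  invFun f v x := f (e.symm x).1 v (e.symm x).2
  left_inv ω := by
    funext v x
    simp
  right_inv f := by
    funext τ v i
    simp

/-- If at most half of the outcomes of a trial are bad, then all of the independent trials are bad
with probability at most `1 / 2 ^ |T|`. -/
theorem coinProb_ge {n r j : ℕ} {T : Type} [Fintype T] (e : T × Fin j ≃ Fin r)
    (good : (Fin n → Fin j → Bool) → Prop) (P : (Fin n → Fin r → Bool) → Prop)
    (hbad : 2 * (Nat.card {ξ // ¬ good ξ} : ℝ) ≤ Fintype.card (Fin n → Fin j → Bool))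
    (hP : ∀ ω, (∃ τ, good (trialBits e ω τ)) → P ω) :
    1 - (1 / 2) ^ Fintype.card T ≤ coinProb n r P := by
  classical
  -- A failing outcome is determined by its restrictions to the trials, each of which is bad.
  have hcard : (Nat.card {ω : Fin n → Fin r → Bool // ¬ P ω} : ℝ) ≤
      (Nat.card {ξ : Fin n → Fin j → Bool // ¬ good ξ} : ℝ) ^ Fintype.card T := by
    have h1 : Nat.card {ω : Fin n → Fin r → Bool // ¬ P ω} ≤
        Nat.card (T → {ξ : Fin n → Fin j → Bool // ¬ good ξ}) := by
      refine Nat.card_le_card_of_injective (fun ω τ => ⟨trialBits e ω.1 τ, fun h =>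
        ω.2 (hP _ ⟨τ, h⟩)⟩) fun ω ω' h => ?_
      refine Subtype.ext ((trialBits e).injective ?_)
      funext τ
      exact congrArg Subtype.val (congrFun h τ)
    rw [Nat.card_fun, Nat.card_eq_fintype_card (α := T)] at h1
    exact_mod_cast h1
  have htot : (Nat.card (Fin n → Fin r → Bool) : ℝ) =
      (Fintype.card (Fin n → Fin j → Bool) : ℝ) ^ Fintype.card T := by
    rw [Nat.card_congr (trialBits e), Nat.card_fun, Nat.card_eq_fintype_card (α := T),
      Nat.card_eq_fintype_card]
    push_cast
    rfl
  have hcompl : (Nat.card {ω : Fin n → Fin r → Bool // P ω} : ℝ) +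
      Nat.card {ω : Fin n → Fin r → Bool // ¬ P ω} = Nat.card (Fin n → Fin r → Bool) := by
    rw [← Nat.cast_add, ← Nat.card_sum, Nat.card_congr (Equiv.sumCompl P)]
  have hpos : (0 : ℝ) < Nat.card (Fin n → Fin r → Bool) := by
    exact_mod_cast Nat.card_pos
  rw [coinProb, le_div_iff₀ hpos]
  have h2 : (Nat.card {ξ : Fin n → Fin j → Bool // ¬ good ξ} : ℝ) ^ Fintype.card T ≤
      (1 / 2) ^ Fintype.card T * Nat.card (Fin n → Fin r → Bool) := by
    rw [htot, ← mul_pow]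
    exact pow_le_pow_left₀ (by positivity) (by linarith) _
  linarith

end Probability

/-! ### Assembling the two algorithms -/

/-- The logarithms cancel in the product of the two bounds, leaving `64 * n ^ 2`. Replacing `n /
S.card` by its integer part costs at most a factor 2, whence 128. -/
theorem IsGood.le_mul {n k : ℕ} (hk : 1 ≤ k) {S : Finset (Fin n)} {t : ℕ} (h : IsGood n k S t)
    (hS : S.Nonempty) : t ≤ n / S.card * 128 * n := by
  have hk' : (0 : ℝ) < k := by exact_mod_cast hk
  have hL : 0 < Real.log (k + 1) := Real.log_pos (by linarith)
  have h1 : S.card * t ≤ 64 * n * n := by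
    have h2 : (S.card : ℝ) * t ≤
        16 * (n * Real.log (k + 1) / k) * (4 * (n * (k / Real.log (k + 1)))) :=
      mul_le_mul h.1 h.2 (by positivity) (by positivity)
    have h3 : 16 * (n * Real.log (k + 1) / k) * (4 * (n * (k / Real.log (k + 1)))) =
        (64 * n * n : ℝ) := by
      field_simp
      ring
    rw [h3] at h2
    exact_mod_cast h2
  have hpos := hS.card_pos
  have hle : S.card ≤ n := (Finset.card_le_univ S).trans_eq (Fintype.card_fin n)
  have hb : 1 ≤ n / S.card := (Nat.one_le_div_iff hpos).2 hle
  have hn : n ≤ 2 * (n / S.card) * S.card := by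
    have := Nat.div_add_mod n S.card
    have := Nat.mod_lt n hpos
    nlinarith
  refine Nat.le_of_mul_le_mul_left (h1.trans ?_) hpos
  calc 64 * n * n ≤ 64 * n * (2 * (n / S.card) * S.card) := Nat.mul_le_mul_left _ hn
    _ = S.card * (n / S.card * 128 * n) := by ring

theorem skeleton_weight_bound {n p : ℕ} {H : WGraph (Fin n)} (h : H.WeightsLE (4 * n ^ (p + 1))) :
    H.WeightsLE (n ^ (p + 3)) := by
  rintro ⟨u, v⟩ he
  refine (h _ he).trans ?_
  have huv : u ≠ v := H.graph.ne_of_adj he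
  have hn : 2 ≤ n := by
    by_contra hn
    exact huv (Fin.ext (by omega))
  rw [show p + 3 = 2 + (p + 1) by ring, pow_add n 2]
  exact Nat.mul_le_mul_right _ (Nat.pow_le_pow_left hn 2)

theorem one_div_pow_trials_le {n : ℕ} (c : ℕ) (hn : 0 < n) :
    (1 / 2 : ℝ) ^ Fintype.card (Trial n c) ≤ 1 / (n : ℝ) ^ c := by
  rw [Fintype.card_prod, Fintype.card_fin, Fintype.card_fin, one_div_pow]
  refine one_div_le_one_div_of_le (by positivity) ?_
  rw [mul_comm, pow_mul]
  exact pow_le_pow_left₀ (by positivity) (by exact_mod_cast (lt_base n).le) c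

open Classical in
/-- The construction of the skeleton graph, as a program for node `v`. -/
noncomputable def construct {n r j : ℕ} [Nonempty (Fin n)] (k M K c β : ℕ)
    (e : Trial n c × Fin j ≃ Fin r) (v : Fin n) (x : LocalInput n × (Fin r → Bool)) :
    Prog n β (LocalSkeleton n) :=
  sample M c β (IsGood n k) v x.1 (fun τ => decide (∀ i, x.2 (e (τ, i)) = true))
    (build M K β v x.1)

/-- The nine rounds are four for sampling and five for building. The largest building message holds
128 optional items of size `p + 8` and one distance, hence `129 * (p + 8)`; the summand `c` covers
the trial data. -/
theorem run_construct {n p c k r j β : ℕ} [Nonempty (Fin n)] (hk : 1 ≤ k)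
    (hβ : c + 129 * (p + 8) ≤ β) (e : Trial n c × Fin j ≃ Fin r) {G : WGraph (Fin n)} {a : ℝ}
    {I : Fin n → LocalInput n} (h : Near G a (n ^ (p + 1)) I) (ω : Fin n → Fin r → Bool)
    (hω : ∃ τ, IsGood n k (cover (fun u => (I u).near) (sampled (trialBits e ω τ)))
      (totalBall (n ^ (p + 1)) I (cover (fun u => (I u).near) (sampled (trialBits e ω τ))))) :
    ∃ (S : Finset (Fin n)) (hS : ∀ x, ((I x).near ∩ S).Nonempty),
      (S.card : ℝ) ≤ 16 * (n * Real.log (k + 1) / k) ∧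
      ∀ v, (Prog.toAlgorithm (construct k (n ^ (p + 1)) (4 * n ^ (p + 1)) c β e)).run 9
        (fun u => (I u, ω u)) v = localSkeleton S (h.skeleton hS) v := by
  classical
  have hsampled (τ : Trial n c) : (Finset.univ.filter fun u =>
      decide (∀ i, ω u (e (τ, i)) = true) = true) = sampled (trialBits e ω τ) := by
    ext u
    rw [sampled]
    simp only [Finset.mem_filter, Finset.mem_univ, true_and, decide_eq_true_eq]
    rfl
  have hval := fits_val n (p + 1) (4 * n ^ (p + 1)) le_rfl
  obtain ⟨τ, S, rfl, hgood, hnext⟩ := next_sample (M := n ^ (p + 1)) (c := c) (β := β)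
    (good := IsGood n k) (I := I) (bits := fun u τ => decide (∀ i, ω u (e (τ, i)) = true))
    ((fits_trials n c).mono (by omega)) (((fits_fin_succ n).pi c).mono (by omega))
    (((fits_bool n).pi c).mono (by omega)) (by simpa only [hsampled] using hω)
    (fun v => build (n ^ (p + 1)) (4 * n ^ (p + 1)) β v (I v))
  set S := cover (fun u => (I u).near) (Finset.univ.filter fun u =>
    decide (∀ i, ω u (e (τ, i)) = true) = true) with hSdef
  have hS (x : Fin n) : ((I x).near ∩ S).Nonempty :=
    cover_hits (N := fun u => (I u).near) (h.self_mem x)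
  refine ⟨S, hS, hgood.1, fun v => ?_⟩
  rw [Prog.run_toAlgorithm, h.localSkeleton_skeleton hS]
  unfold construct
  rw [Function.iterate_add_apply _ 5 4]
  simp only []
  rw [hnext, next_build (n ^ (p + 1)) (4 * n ^ (p + 1))
    (((fits_fin n).prod (hval.prod (fits_fin_succ n))).mono (by omega))
    ((((fits_fin n).prod hval).option).mono (by omega))
    ((((((fits_fin n).prod ((fits_fin n).prod hval)).option).pi 128).prod hval).mono (by omega))
    (hval.mono (by omega)) le_rfl h.edges_le
    (hgood.le_mul hk ⟨_, hub_mem (n ^ (p + 1)) hS (Classical.arbitrary _)⟩)]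
  rfl

theorem run_extend {n p β : ℕ} [Nonempty (Fin n)] (hβ : 129 * (p + 8) ≤ β) {G : WGraph (Fin n)}
    {a : ℝ} (ha : 1 ≤ a) {I : Fin n → LocalInput n} (h : Near G a (n ^ (p + 1)) I)
    {S : Finset (Fin n)} (hS : ∀ x, ((I x).near ∩ S).Nonempty) {l : ℝ} (hl : 1 ≤ l)
    {D : Fin n → Fin n → ℝ≥0∞} (hD : IsApproxOn S l (h.skeleton hS).dist D) :
    IsApproxOn Finset.univ (7 * l * a ^ 2) G.dist
      ((Prog.toAlgorithm fun v (x : LocalInput n × LocalSkeleton n × (Fin n → Option ℝ≥0∞)) =>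
        extend (n ^ (p + 1)) (4 * n ^ (p + 2)) β v x.1 x.2.1.isNode x.2.2).run 3
        fun u => (I u, localSkeleton S (h.skeleton hS) u, distRow S D u)) := by
  classical
  have hval := fits_val n (p + 2) (4 * n ^ (p + 2)) le_rfl
  -- Skeleton weights are at most `4 * n ^ (p + 1)`, so `4 * n ^ (p + 2)` bounds all finite skeleton
  -- distances.
  have hM : n * (4 * n ^ (p + 1)) ≤ 4 * n ^ (p + 2) := by
    rw [pow_succ n (p + 1)]
    exact le_of_eq (by ring)
  have hM' : n ^ (p + 1) ≤ 4 * n ^ (p + 2) := by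
    have := (Classical.arbitrary (Fin n)).pos
    have h1 := Nat.pow_le_pow_right this (by omega : p + 1 ≤ p + 2)
    omega
  have key := extend_approx h hS ha hl hM hD
  convert key using 1
  funext v
  rw [Prog.run_toAlgorithm]
  exact congrArg Prog.out (congrFun (next_extend (n ^ (p + 1)) (4 * n ^ (p + 2))
    (I := I) (S := S) (distRow S D) ((fits_bool n).mono (by omega))
    (((fits_fin n).prod (hval.prod hval)).mono (by omega)) (hval.mono (by omega)) hM') v)

end CongestedClique

/-- `C` is the constant in the size of the skeleton graph. For edge weights at most `n ^ p` and
failure probability at most `1 / n ^ c`, messages have `O(β log n)` bits, the skeleton graph has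
weights at most `n ^ q`, the randomized construction `A` takes `R₁` rounds and the deterministic
extension `B` takes `R₂` rounds. The algorithms depend on `n` and `k` only. -/
theorem lemma6p1 :
    ∃ C : ℝ, ∀ p c : ℕ, ∃ β q R₁ R₂ : ℕ, ∀ n k : ℕ, 1 ≤ k →
      ∃ (r : ℕ)
        (A : CongestedClique.Algorithm n β (LocalInput n × (Fin r → Bool)) (LocalSkeleton n))
        (B : CongestedClique.Algorithm n β
          (LocalInput n × LocalSkeleton n × (Fin n → Option ℝ≥0∞)) (Fin n → ℝ≥0∞)),
        ∀ G : WGraph (Fin n), G.WeightsLE (n ^ p) →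
        ∀ a : ℝ, 1 ≤ a →
        ∀ δ : Fin n → Fin n → ℤ, (∀ u v, δ u v = δ v u) →
        ∀ N : Fin n → Finset (Fin n), (∀ u, (N u).card = k) →
        IsLocalApprox G a δ N →
        1 - 1 / (n : ℝ) ^ c ≤ CongestedClique.coinProb n r (fun ω =>
          ∃ (S : Finset (Fin n)) (H : WGraph (Fin n)),
            (∀ v, A.run R₁ (fun u => (localInput G δ N u, ω u)) v = localSkeleton S H v) ∧
            H.IsOver S ∧
            H.WeightsLE (n ^ q) ∧
            (S.card : ℝ) ≤ C * (n * Real.log (k + 1) / k) ∧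
            ∀ l : ℝ, 1 ≤ l →
            ∀ D : Fin n → Fin n → ℝ≥0∞, IsApproxOn S l H.dist D →
              IsApproxOn Finset.univ (7 * l * a ^ 2) G.dist
                (B.run R₂ (fun u => (localInput G δ N u, localSkeleton S H u, distRow S D u)))) := by
  classical
  refine ⟨16, fun p c => ⟨c + 129 * (p + 8), p + 3, 9, 3, fun n k hk => ?_⟩⟩
  -- Without nodes there is nothing to encode or decode, so this case is treated apart; every claim
  -- is vacuous and the probability is 1.
  rcases Nat.eq_zero_or_pos n with rfl | hn
  · refine ⟨0, CongestedClique.Prog.toAlgorithm fun v => v.elim0,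
      CongestedClique.Prog.toAlgorithm fun v => v.elim0, ?_⟩
    intro G _ a _ δ _ N _ _
    have hP : ∀ P : (Fin 0 → Fin 0 → Bool) → Prop, (∀ ω, P ω) →
        CongestedClique.coinProb 0 0 P = 1 := by
      intro P hP
      rw [CongestedClique.coinProb, Nat.card_congr (Equiv.subtypeUnivEquiv hP)]
      simp
    rw [hP]
    · have : (0 : ℝ) ≤ 1 / ((0 : ℕ) : ℝ) ^ c := by positivity
      linarith
    · exact fun ω => ⟨∅, G, fun v => v.elim0, fun u => u.elim0,
        by rintro ⟨u, -⟩; exact u.elim0, by simp, fun l _ D _ u => u.elim0⟩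
  · have : Nonempty (Fin n) := ⟨⟨0, hn⟩⟩
    obtain ⟨j, hj, hj'⟩ := CongestedClique.exists_bits k hk
    let e : CongestedClique.Trial n c × Fin j ≃
        Fin (Fintype.card (CongestedClique.Trial n c × Fin j)) := Fintype.equivFin _
    refine ⟨_, CongestedClique.Prog.toAlgorithm
        (CongestedClique.construct k (n ^ (p + 1)) (4 * n ^ (p + 1)) c _ e),
      CongestedClique.Prog.toAlgorithm fun v x =>
        CongestedClique.extend (n ^ (p + 1)) (4 * n ^ (p + 2)) _ v x.1 x.2.1.isNode x.2.2, ?_⟩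
    intro G hG a ha δ _ N hN hδ
    have h := CongestedClique.near_localInput hG ha hk hN hδ
    refine le_trans ?_ (CongestedClique.coinProb_ge e (fun ξ => CongestedClique.IsGood n k
      (CongestedClique.cover N (CongestedClique.sampled ξ))
      (CongestedClique.totalBall (n ^ (p + 1)) (localInput G δ N)
        (CongestedClique.cover N (CongestedClique.sampled ξ)))) _ ?_ ?_)
    · have := CongestedClique.one_div_pow_trials_le c hn
      linarith
    · have := CongestedClique.card_bad_le (n ^ (p + 1)) hn hk hj hj'
        (I := localInput G δ N) h.self_mem hN
      rw [Nat.card_eq_fintype_card, Fintype.card_subtype]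
      exact this
    · intro ω hω
      obtain ⟨S, hS, hcard, hrun⟩ := CongestedClique.run_construct hk le_rfl e h ω hω
      exact ⟨S, h.skeleton hS, hrun, h.skeleton_isOver hS,
        CongestedClique.skeleton_weight_bound (h.skeleton_weightsLE hS), hcard,
        fun l hl D hD => CongestedClique.run_extend (by omega) ha h hS hl hD⟩
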